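/- Let $\alpha\in(0,1)$, $\sigma(x)=\frac1\alpha 1_{\{x\ge0\}}+\frac1{1-\alpha}1_{\{x<0\}}$, and $\Lambda(x)=\int_a^x\frac{ds}{\sigma(s)}$ for a fixed $a\in\mathbb R$. Let $T>0$, $\frac12<\gamma<H<1$, and let $B^H$ be a fractional Brownian motion with Hurst parameter $H$ and continuous paths, on a probability space $(\Omega,\mathcal F,\mathbb P)$. Fractional integrals. For $\theta\in(0,1)$, $p\ge1$ and $f\in L^p([a,b])$, extended by $0$ outside $[a,b]$, put $$D^\theta_{a+}f(t)=L^p\text{-}\lim_{\varepsilon\downarrow0}\frac1{\Gamma(1-\theta)}\Big(\frac{f_t}{(t-a)^\theta}+\theta\int_a^{t-\varepsilon}\frac{f_t-f_r}{(t-r)^{1+\theta}}dr\Big),$$ $$D^\theta_{b-}f(t)=L^p\text{-}\lim_{\varepsilon\downarrow0}\frac1{\Gamma(1-\theta)}\Big(\frac{f_t}{(b-t)^\theta}+\theta\int_{t+\varepsilon}^b\frac{f_t-f_r}{(r-t)^{1+\theta}}dr\Big),$$ when the limits exist. With $g^{b-}_r=g_r-g_{b-}$, the function $f$ is integrable with respect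 to $g$ at order $\theta$ if $D^\theta_{a+}f$ and $D^{1-\theta}_{b-}g^{b-}$ exist (for a common $p\ge1$) and their product is in $L^1([a,b])$; then $\int_a^bf\,dg:=-\int_a^b(D^\theta_{a+}f)(r)\,(D^{1-\theta}_{b-}g^{b-})(r)\,dr$. Let $x=(x_t)_{t\in[0,T]}$ be a process such that almost surely $x_t=x_0+\int_0^t\sigma(x_s)\,dB^H_s$ for all $t\in[0,T]$, where the integral is understood pathwise in the above sense (at some order $\theta\in(1-H,1)$), and let $G$ be a random variable such that almost surely $|x_s-x_t|\le G|s-t|^\gamma$ for all $s,t\in[0,T]$. Let $1-\gamma<\tilde\alpha<\gamma$ and suppose that: 1. almost surely, $1_{\{0\le r<s<T\}}\dfrac{\sigma(x_s)-\sigma(x_r)}{(s-r)^{1+\tilde\alpha}}\in L^1([0,T]^2)$; 2. almost surely, $\int_0^T1_{\{x_s=0\}}ds=0$; 3. for some $\varepsilon>0$, the function $f_\gamma(s)=\mathbb E\big(G^{(\tilde\alpha+\varepsilon)/\gamma}|x_s|^{-(\tilde\alpha+\varepsilon)/\gamma}\big)$ is in $L^1([0,T])$; 4. for some $\eta<1-\frac{\tilde\alpha}\gamma$,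 some $p\in(1,\frac1{1-\eta})$ and $q$ with $\frac1p+\frac1q=1$, one has $G^{1-\eta}\in L^q(\mathbb P)$, and there is $g\in L^{1/p}([0,T])$ (that is, $\int_0^T|g(s)|^{1/p}ds<\infty$) such that for almost every $s\in[0,T]$, $\mathbb P(u<x_s\le v)\le g(s)(v-u)$ for all $u<v$. Then almost surely, for all $t\in[0,T]$, $$\Lambda(x_t)-\Lambda(x_0)=B^H_t ,$$ and $x_t$ is the only real number $y$ with $\Lambda(y)=\Lambda(x_0)+B^H_t$; that is, $x_t=\Lambda^{-1}(\Lambda(x_0)+B^H_t)$, so $x$ is determined by $x_0$ and $B^H$. -/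

import Mathlib

open MeasureTheory ProbabilityTheory Set Filter Topology
open scoped ENNReal NNReal

noncomputable section

/-- A (continuous) fractional Brownian motion `(B t)` for `t ≥ 0`, of Hurst parameter `H`, under `P`:
a centred Gaussian process with covariance `(|t|^{2H} + |s|^{2H} - |t - s|^{2H}) / 2`, whose
paths are almost surely continuous on `[0, ∞)`. Values of `B` at negative times play no role. -/
structure IsFractionalBrownianMotion {Ω : Type*} [MeasurableSpace Ω] (H : ℝ)
    (B : ℝ → Ω → ℝ) (P : Measure Ω) : Prop where
  gaussian : IsGaussianProcess (fun (t : ℝ≥0) (ω : Ω) => B (t : ℝ) ω) P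
  centered : ∀ t : ℝ, 0 ≤ t → ∫ ω, B t ω ∂P = 0
  covariance : ∀ s t : ℝ, 0 ≤ s → 0 ≤ t →
    ∫ ω, B t ω * B s ω ∂P =
      (1 / 2) * (|t| ^ (2 * H) + |s| ^ (2 * H) - |t - s| ^ (2 * H))
  continuous_paths : ∀ᵐ ω ∂P, ContinuousOn (fun t => B t ω) (Ici 0)

/-- The discontinuous coefficient `σ = (1/α) 1_{x ≥ 0} + (1/(1-α)) 1_{x < 0}`. -/
def sigma (α x : ℝ) : ℝ := if 0 ≤ x then 1 / α else 1 / (1 - α)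

/-- `Λ(x) = ∫_a^x ds / σ(s)`. -/
def Lambda (α a x : ℝ) : ℝ := ∫ s in a..x, 1 / sigma α s

/-- The truncated left fractional (Marchaud) derivative of order `θ` on `[a, b]`. The function is
extended by `0` outside `[a, b]`; the integral from `a` to `t - ε` is oriented, so for `t < a + ε`
it is minus the integral over `[t - ε, a]`. -/
def leftFracDerivTrunc (θ a b ε : ℝ) (f : ℝ → ℝ) (t : ℝ) : ℝ :=
  1 / Real.Gamma (1 - θ) *
    (f t / (t - a) ^ θ
      + θ * ∫ r in a..(t - ε), (f t - (Icc a b).indicator f r) / (t - r) ^ (1 + θ))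

/-- The truncated right fractional (Marchaud) derivative of order `θ` on `[a, b]`. -/
def rightFracDerivTrunc (θ a b ε : ℝ) (f : ℝ → ℝ) (t : ℝ) : ℝ :=
  1 / Real.Gamma (1 - θ) *
    (f t / (b - t) ^ θ
      + θ * ∫ r in (t + ε)..b, (f t - (Icc a b).indicator f r) / (r - t) ^ (1 + θ))

/-- `φ` is the left fractional derivative `D_{a+}^θ f` of `f ∈ L^p([a, b])`: the `L^p` limit, as
`ε ↓ 0`, of the truncated derivatives. -/
def HasLeftFracDeriv (θ : ℝ) (p : ℝ≥0∞) (a b : ℝ) (f φ : ℝ → ℝ) : Prop :=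
  MemLp f p (volume.restrict (Icc a b)) ∧ MemLp φ p (volume.restrict (Icc a b)) ∧
    Tendsto (fun ε : ℝ => eLpNorm (fun t => leftFracDerivTrunc θ a b ε f t - φ t) p
      (volume.restrict (Icc a b))) (𝓝[>] 0) (𝓝 0)

/-- `φ` is the right fractional derivative `D_{b-}^θ f` of `f ∈ L^p([a, b])`. -/
def HasRightFracDeriv (θ : ℝ) (p : ℝ≥0∞) (a b : ℝ) (f φ : ℝ → ℝ) : Prop :=
  MemLp f p (volume.restrict (Icc a b)) ∧ MemLp φ p (volume.restrict (Icc a b)) ∧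
    Tendsto (fun ε : ℝ => eLpNorm (fun t => rightFracDerivTrunc θ a b ε f t - φ t) p
      (volume.restrict (Icc a b))) (𝓝[>] 0) (𝓝 0)

/-- `f` is integrable with respect to `g` on `[a, b]`, at order `θ`, with (generalized Young)
integral `∫_a^b f dg = I`. Here `g^{b-} = g - g(b-)`. Both one-sided derivatives above are taken
without the usual complex factors `(-1)^θ`; these multiply to the sign `-1` in front of the
integral, which makes `∫_a^b 1 dg = g(b) - g(a)`. -/
def HasFracIntegral (θ a b : ℝ) (f g : ℝ → ℝ) (I : ℝ) : Prop :=
  ∃ (p : ℝ≥0∞) (φ ψ : ℝ → ℝ), 1 ≤ p ∧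
    HasLeftFracDeriv θ p a b f φ ∧
    HasRightFracDeriv (1 - θ) p a b (fun r => g r - Function.leftLim g b) ψ ∧
    IntegrableOn (fun r => φ r * ψ r) (Icc a b) ∧
    I = -∫ r in a..b, φ r * ψ r

/-- The path `ξ` solves `ξ_t = ξ_0 + ∫_0^t σ(ξ_s) dβ_s` for `t ∈ [0, T]` (at `t = 0` the equation
is void). The order of the generalized Young integral may be any `θ ∈ (1 - H, 1)`, `H` being the
Hölder regularity of the driver (excluding the end point). -/
def IsPathwiseSolution (α H T : ℝ) (β ξ : ℝ → ℝ) : Prop :=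
  ∀ t ∈ Ioc 0 T, ∃ θ ∈ Ioo (1 - H) 1,
    HasFracIntegral θ 0 t (fun s => sigma α (ξ s)) β (ξ t - ξ 0)

/-- `E[G^r |X|^{-r}]` with values in `[0, ∞]`; here `0^{-r} = ∞` for `r > 0`. -/
def negMoment {Ω : Type*} [MeasurableSpace Ω] (P : Measure Ω) (G X : Ω → ℝ) (r : ℝ) : ℝ≥0∞ :=
  ∫⁻ ω, ENNReal.ofReal (G ω) ^ r * ENNReal.ofReal |X ω| ^ (-r) ∂P

end

/-! Away from the zeros of `x` the coefficient is locally constant, so there the equation reads dx =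
σ dB, and `Λ(x) - B` does not move. The theorem follows once the zeros are shown to be too sparse
for `Λ(x) - B` to move across them.

Sparseness (`ae_summable_card_zeroIntervals`). If a dyadic interval of length δ contains a zero,
then |x_s| ≤ G δ^γ throughout it, so Markov's inequality and the negative moment in hypothesis 3,
with ρ = α' + ε, bound the expected number N of such intervals by a constant times δ^(ρ-1). As ρ + γ
> 1, the sum over all levels of N δ^γ is almost surely finite. In
`IsPathwiseSolution.Lambda_sub_eq`, `Λ(x) - B` is telescoped along the grid: an interval with a zero
contributes at most a constant times δ^γ, any other contributes nothing, and the total tends to 0.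

What remains is that dx = σ dB on an interval without zeros. This is not immediate, because the
equation only gives integrals from 0 to t, whose order θ may depend on t, and additivity in the
interval is not part of the definition. It is obtained by identifying every such integral with the
limit of the same dyadic Riemann sums (`HasFracIntegral.tendsto_riemannSum`). Integration by parts
moves the truncated derivative of order θ from f to ψ, the derivative of order 1 - θ of the
integrator g, and the integral becomes the limit of ∫ f χ_ε with continuous densities χ_ε. The
integral of χ_ε over [u, v] is an average of the increments g(v + εz) - g(u + εz), with g extended
by constants, against a probability density built from `fracKernel`. It therefore inherits the
Hölder bound of g uniformly in ε and tends to g(v) - g(u). Refining a Riemann sum changes it only on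
intervals where f is not constant; the summability above bounds these changes uniformly in ε and
lets ε → 0 be exchanged with the refinement. -/

/-! ### The averaging kernel and its total mass. -/

theorem integrableOn_and_integral_rpow_mul_one_sub_rpow {θ : ℝ} (h0 : 0 < θ) (h1 : θ < 1) :
    IntegrableOn (fun x : ℝ => x ^ (-θ) * (1 - x) ^ (θ - 1)) (Ioo 0 1) ∧
    ∫ x in Ioo (0 : ℝ) 1, x ^ (-θ) * (1 - x) ^ (θ - 1) = Real.Gamma θ * Real.Gamma (1 - θ) := by
  have hconv := Complex.betaIntegral_convergent (u := ((1 - θ : ℝ) : ℂ)) (v := (θ : ℂ))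
    (by simp; linarith) (by simpa using h0)
  have hval := Complex.Gamma_mul_Gamma_eq_betaIntegral (s := ((1 - θ : ℝ) : ℂ)) (t := (θ : ℂ))
    (by simp; linarith) (by simpa using h0)
  have hsum : ((1 - θ : ℝ) : ℂ) + (θ : ℂ) = 1 := by push_cast; ring
  rw [hsum, Complex.Gamma_one, one_mul, Complex.betaIntegral,
    intervalIntegral.integral_of_le zero_le_one, integral_Ioc_eq_integral_Ioo] at hval
  rw [intervalIntegrable_iff_integrableOn_Ioo_of_le zero_le_one] at hconv
  have heq : EqOn (fun x : ℝ => (x : ℂ) ^ (((1 - θ : ℝ) : ℂ) - 1) * (1 - (x : ℂ)) ^ ((θ : ℂ) - 1))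
      (fun x : ℝ => ((x ^ (-θ) * (1 - x) ^ (θ - 1) : ℝ) : ℂ)) (Ioo 0 1) := by
    intro x hx
    have e1 : (((1 - θ : ℝ) : ℂ) - 1) = ((-θ : ℝ) : ℂ) := by push_cast; ring
    have e2 : ((θ : ℂ) - 1) = ((θ - 1 : ℝ) : ℂ) := by push_cast; ring
    have e3 : (1 - (x : ℂ)) = ((1 - x : ℝ) : ℂ) := by push_cast; ring
    simp only [e1, e2, e3]
    rw [← Complex.ofReal_cpow hx.1.le, ← Complex.ofReal_cpow (by linarith [hx.2])]
    push_cast; rfl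
  rw [integrableOn_congr_fun heq measurableSet_Ioo] at hconv
  rw [setIntegral_congr_fun measurableSet_Ioo heq, integral_complex_ofReal, Complex.Gamma_ofReal,
    Complex.Gamma_ofReal] at hval
  refine ⟨?_, ?_⟩
  · have := hconv.re
    simpa [IntegrableOn] using this
  · rw [mul_comm]; exact_mod_cast hval.symm

/-- The substitution u = 1/x turns this into the Beta integral above. -/
theorem integrableOn_and_integral_sub_one_rpow_div {θ : ℝ} (h0 : 0 < θ) (h1 : θ < 1) :
    IntegrableOn (fun u : ℝ => (u - 1) ^ (θ - 1) / u) (Ioi 1) ∧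
    ∫ u in Ioi (1 : ℝ), (u - 1) ^ (θ - 1) / u = Real.Gamma θ * Real.Gamma (1 - θ) := by
  obtain ⟨hi, hv⟩ := integrableOn_and_integral_rpow_mul_one_sub_rpow h0 h1
  set g : ℝ → ℝ := (Ioi (1 : ℝ)).indicator (fun u => (u - 1) ^ (θ - 1) / u) with hg
  have key : EqOn (fun x : ℝ => (|(-1 : ℝ)| * x ^ ((-1 : ℝ) - 1)) • g (x ^ (-1 : ℝ)))
      ((Ioo (0 : ℝ) 1).indicator (fun x : ℝ => x ^ (-θ) * (1 - x) ^ (θ - 1))) (Ioi 0) := by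
    intro x hx
    have hx : 0 < x := hx
    simp only [hg, indicator, Real.rpow_neg_one, mem_Ioi, mem_Ioo, smul_eq_mul, hx, true_and]
    simp only [one_lt_inv₀ hx]
    split_ifs with h
    · have : x⁻¹ - 1 = (1 - x) * x⁻¹ := by field_simp
      rw [this, Real.mul_rpow (by linarith) (by positivity), Real.inv_rpow hx.le,
        ← Real.rpow_neg hx.le, div_inv_eq_mul]
      have : x ^ (-θ) = x ^ ((-1 : ℝ) - 1) * x ^ (-(θ - 1)) * x := by
        rw [← Real.rpow_add hx, ← Real.rpow_add_one hx.ne']; congr 1; ring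
      rw [this]; simp; ring
    · simp
  have hsub : Ioi (1 : ℝ) ⊆ Ioi 0 := Ioi_subset_Ioi zero_le_one
  have hgi : IntegrableOn g (Ioi 0) := by
    rw [← integrableOn_Ioi_comp_rpow_iff g (by norm_num : (-1 : ℝ) ≠ 0),
      integrableOn_congr_fun key measurableSet_Ioi]
    exact (hi.integrable_indicator measurableSet_Ioo).integrableOn
  constructor
  · have := hgi.mono_set hsub
    refine (integrableOn_congr_fun ?_ measurableSet_Ioi).1 this
    intro x hx
    simp [hg, mem_Ioi.1 hx]
  · have e1 := integral_comp_rpow_Ioi g (by norm_num : (-1 : ℝ) ≠ 0)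
    rw [setIntegral_congr_fun measurableSet_Ioi key, setIntegral_indicator measurableSet_Ioo,
      hg, setIntegral_indicator measurableSet_Ioi] at e1
    rw [inter_eq_right.2 hsub, inter_eq_right.2 Ioo_subset_Ioi_self, hv] at e1
    exact e1.symm

/-- The kernel `K(u) = (u^θ - (u-1)_+^θ) / u`, up to its normalization. -/
noncomputable def fracKernel (θ u : ℝ) : ℝ := (u ^ θ - (max (u - 1) 0) ^ θ) / u

theorem fracKernel_nonneg {θ u : ℝ} (h0 : 0 < θ) (hu : 0 < u) : 0 ≤ fracKernel θ u := by
  refine div_nonneg (sub_nonneg.2 ?_) hu.le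
  exact Real.rpow_le_rpow (le_max_right _ _) (max_le (by linarith) hu.le) h0.le

/-- Since (1 - 1/u)^θ ≥ 1 - 1/u, the difference u^θ - (u-1)^θ is at most u^(θ-1). This gives the
boundary value at infinity in the computation of the mass of the kernel. -/
theorem tendsto_rpow_sub_sub_one_rpow {θ : ℝ} (h0 : 0 < θ) (h1 : θ < 1) :
    Tendsto (fun u : ℝ => (u ^ θ - (u - 1) ^ θ) / θ) atTop (𝓝 0) := by
  have hup : Tendsto (fun u : ℝ => u ^ (θ - 1) / θ) atTop (𝓝 0) := by
    have := (tendsto_rpow_neg_atTop (y := 1 - θ) (by linarith)).div_const θ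
    simpa using this
  refine tendsto_of_tendsto_of_tendsto_of_le_of_le' tendsto_const_nhds hup ?_ ?_
  · filter_upwards [eventually_ge_atTop 1] with u hu
    refine div_nonneg (sub_nonneg.2 ?_) h0.le
    exact Real.rpow_le_rpow (by linarith) (by linarith) h0.le
  · filter_upwards [eventually_gt_atTop 1] with u hu
    gcongr
    have hu0 : 0 < u := by linarith
    have e : u - 1 = u * (1 - 1 / u) := by field_simp
    have hle : 1 / u ≤ 1 := by rw [div_le_one hu0]; exact hu.le
    have hb : 1 - 1 / u ≤ (1 - 1 / u) ^ θ := by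
      have := Real.rpow_le_rpow_of_exponent_ge' (x := 1 - 1 / u) (by linarith)
        (by have : 0 < 1 / u := by positivity
            linarith) h0.le h1.le
      simpa using this
    rw [e, Real.mul_rpow hu0.le (by linarith), Real.rpow_sub_one hu0.ne']
    have hp : 0 < u ^ θ := by positivity
    have : u ^ θ * (1 - 1 / u) ≤ u ^ θ * (1 - 1 / u) ^ θ := by gcongr
    calc u ^ θ - u ^ θ * (1 - 1 / u) ^ θ ≤ u ^ θ - u ^ θ * (1 - 1 / u) := by linarith
      _ = u ^ θ / u := by ring

/-- On (0, 1] the kernel is u^(θ-1), of integral 1/θ. On (1, ∞) it is the derivative of (u^θ -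
(u-1)^θ)/θ, of integral -1/θ, plus (u-1)^(θ-1)/u, which carries the product of Gamma values. -/
theorem integrableOn_and_integral_fracKernel {θ : ℝ} (h0 : 0 < θ) (h1 : θ < 1) :
    IntegrableOn (fracKernel θ) (Ioi 0) ∧
    ∫ u in Ioi (0 : ℝ), fracKernel θ u = Real.Gamma θ * Real.Gamma (1 - θ) := by
  obtain ⟨hi, hv⟩ := integrableOn_and_integral_sub_one_rpow_div h0 h1
  have e1 : EqOn (fracKernel θ) (fun u => u ^ (θ - 1)) (Ioc 0 1) := by
    intro u hu
    simp [fracKernel, max_eq_right (sub_nonpos.2 hu.2), Real.zero_rpow h0.ne',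
      Real.rpow_sub_one hu.1.ne']
  have e2 : EqOn (fracKernel θ)
      (fun u => (u ^ (θ - 1) - (u - 1) ^ (θ - 1)) + (u - 1) ^ (θ - 1) / u) (Ioi 1) := by
    intro u hu
    have hu : 1 < u := hu
    have hu0 : u ≠ 0 := by linarith
    have : u - 1 ≠ 0 := by linarith
    simp only [fracKernel]
    rw [max_eq_left (by linarith), Real.rpow_sub_one hu0, Real.rpow_sub_one this]
    field_simp
    ring
  have hder : ∀ u ∈ Ioi (1 : ℝ), HasDerivAt (fun u : ℝ => (u ^ θ - (u - 1) ^ θ) / θ)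
      (u ^ (θ - 1) - (u - 1) ^ (θ - 1)) u := by
    intro u hu
    have hu : 1 < u := hu
    have d1 := Real.hasDerivAt_rpow_const (x := u) (p := θ) (Or.inl (by linarith))
    have d2 := (Real.hasDerivAt_rpow_const (x := u - 1) (p := θ) (Or.inl (by linarith))).comp u
      ((hasDerivAt_id u).sub_const 1)
    have := (d1.sub d2).div_const θ
    convert! this using 1
    field_simp
  have hneg : ∀ u ∈ Ioi (1 : ℝ), u ^ (θ - 1) - (u - 1) ^ (θ - 1) ≤ 0 := by
    intro u hu
    have hu : 1 < u := hu
    have := Real.rpow_le_rpow_of_nonpos (x := u - 1) (y := u) (z := θ - 1) (by linarith)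
      (by linarith) (by linarith)
    linarith
  have hcont : ContinuousWithinAt (fun u : ℝ => (u ^ θ - (u - 1) ^ θ) / θ) (Ici 1) 1 := by
    refine ContinuousAt.continuousWithinAt ?_
    refine ContinuousAt.div_const (ContinuousAt.sub ?_ ?_) θ
    · exact ContinuousAt.rpow_const continuousAt_id (Or.inr h0.le)
    · exact ContinuousAt.rpow_const (by fun_prop) (Or.inr h0.le)
  have hI := integrableOn_Ioi_deriv_of_nonpos hcont hder hneg (tendsto_rpow_sub_sub_one_rpow h0 h1)
  have hV := integral_Ioi_of_hasDerivAt_of_nonpos hcont hder hneg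
    (tendsto_rpow_sub_sub_one_rpow h0 h1)
  have hi1 : IntegrableOn (fracKernel θ) (Ioc 0 1) := by
    rw [integrableOn_congr_fun e1 measurableSet_Ioc,
      ← intervalIntegrable_iff_integrableOn_Ioc_of_le zero_le_one]
    exact intervalIntegral.intervalIntegrable_rpow' (by linarith)
  have hi2 : IntegrableOn (fracKernel θ) (Ioi 1) := by
    rw [integrableOn_congr_fun e2 measurableSet_Ioi]
    exact hI.add hi
  rw [← Ioc_union_Ioi_eq_Ioi zero_le_one]
  refine ⟨hi1.union hi2, ?_⟩
  rw [setIntegral_union (Ioc_disjoint_Ioi le_rfl) measurableSet_Ioi hi1 hi2,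
    setIntegral_congr_fun measurableSet_Ioc e1, setIntegral_congr_fun measurableSet_Ioi e2,
    integral_add hI hi, hV, hv, ← intervalIntegral.integral_of_le zero_le_one,
    integral_rpow (Or.inl (by linarith))]
  simp [Real.zero_rpow h0.ne']

/-! ### Marchaud derivatives on the line. -/

/-- The right Marchaud derivative of order `θ` on the line, truncated at `ε`. -/
noncomputable def marchaud (θ ε : ℝ) (h : ℝ → ℝ) (s : ℝ) : ℝ :=
  θ / Real.Gamma (1 - θ) * ∫ w in Ioi ε, (h s - h (s + w)) * w ^ (-1 - θ)

section
variable {θ ε : ℝ} {h D : ℝ → ℝ}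

/-- The dominating function is left abstract to serve two cases: ε > 0 with h bounded, and ε = 0
with h bounded and Hölder continuous of exponent larger than θ. It does not depend on s, whence both
the continuity and the uniform bound. -/
theorem marchaud_regular (hc : Continuous h) (hD : IntegrableOn D (Ioi ε))
    (hbd : ∀ s, ∀ w ∈ Ioi ε, |(h s - h (s + w)) * w ^ (-1 - θ)| ≤ D w) :
    Continuous (marchaud θ ε h) ∧ ∃ K, 0 ≤ K ∧ ∀ s, |marchaud θ ε h s| ≤ K := by
  have hm : ∀ s, AEStronglyMeasurable (fun w => (h s - h (s + w)) * w ^ (-1 - θ))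
      (volume.restrict (Ioi ε)) := fun s =>
    ((measurable_const.sub (hc.measurable.comp (measurable_const.add measurable_id))).mul
      (measurable_id.pow_const _)).aestronglyMeasurable
  have hb : ∀ s, ∀ᵐ w ∂(volume.restrict (Ioi ε)),
      ‖(h s - h (s + w)) * w ^ (-1 - θ)‖ ≤ D w := fun s =>
    (ae_restrict_mem measurableSet_Ioi).mono fun w hw => hbd s w hw
  constructor
  · refine continuous_const.mul (continuous_of_dominated hm hb hD ?_)
    exact ae_of_all _ fun w => by fun_prop
  · refine ⟨|θ / Real.Gamma (1 - θ)| * ∫ w in Ioi ε, D w, ?_, fun s => ?_⟩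
    · refine mul_nonneg (abs_nonneg _) (setIntegral_nonneg measurableSet_Ioi fun w hw => ?_)
      exact (abs_nonneg _).trans (hbd 0 w hw)
    · rw [marchaud, abs_mul]
      gcongr
      exact norm_integral_le_of_norm_le hD (hb s)

theorem integral_marchaud (hc : Continuous h) (hD : IntegrableOn D (Ioi ε))
    (hbd : ∀ s, ∀ w ∈ Ioi ε, |(h s - h (s + w)) * w ^ (-1 - θ)| ≤ D w) {u v : ℝ} (huv : u ≤ v) :
    IntegrableOn (fun w => (∫ s in u..v, (h s - h (s + w))) * w ^ (-1 - θ)) (Ioi ε) ∧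
    ∫ s in u..v, marchaud θ ε h s =
      θ / Real.Gamma (1 - θ) *
        ∫ w in Ioi ε, (∫ s in u..v, (h s - h (s + w))) * w ^ (-1 - θ) := by
  have hm : AEStronglyMeasurable
      (fun p : ℝ × ℝ => (h p.1 - h (p.1 + p.2)) * p.2 ^ (-1 - θ))
      ((volume.restrict (Ioc u v)).prod (volume.restrict (Ioi ε))) := by
    refine Measurable.aestronglyMeasurable ?_
    have := hc.measurable
    refine Measurable.mul ?_ (measurable_snd.pow_const _)
    exact (this.comp measurable_fst).sub (this.comp (measurable_fst.add measurable_snd))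
  have hint : Integrable (fun p : ℝ × ℝ => (h p.1 - h (p.1 + p.2)) * p.2 ^ (-1 - θ))
      ((volume.restrict (Ioc u v)).prod (volume.restrict (Ioi ε))) := by
    refine Integrable.mono' (Integrable.comp_snd hD (volume.restrict (Ioc u v))) hm ?_
    rw [Measure.prod_restrict]
    exact (ae_restrict_mem (measurableSet_Ioc.prod measurableSet_Ioi)).mono
      fun p hp => hbd p.1 p.2 hp.2
  have e : ∀ w, (∫ s in u..v, (h s - h (s + w))) * w ^ (-1 - θ) =
      ∫ s in Ioc u v, (h s - h (s + w)) * w ^ (-1 - θ) := fun w => by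
    rw [← intervalIntegral.integral_mul_const, intervalIntegral.integral_of_le huv]
  simp only [e]
  refine ⟨hint.integral_prod_right, ?_⟩
  simp only [marchaud]
  rw [intervalIntegral.integral_const_mul, intervalIntegral.integral_of_le huv,
    integral_integral_swap hint]

theorem integrableOn_const_mul_rpow_Ioi (hθ : 0 < θ) (hε : 0 < ε) (M : ℝ) :
    IntegrableOn (fun w : ℝ => M * w ^ (-1 - θ)) (Ioi ε) :=
  (integrableOn_Ioi_rpow_of_lt (by linarith) hε).const_mul _

theorem bound_of_bounded (hε : 0 ≤ ε) {M : ℝ} (hM : ∀ s, |h s| ≤ M) (s : ℝ) {w : ℝ}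
    (hw : w ∈ Ioi ε) : |(h s - h (s + w)) * w ^ (-1 - θ)| ≤ 2 * M * w ^ (-1 - θ) := by
  have hw : 0 < w := lt_of_le_of_lt hε hw
  rw [abs_mul, abs_of_pos (Real.rpow_pos_of_pos hw _)]
  gcongr
  have := abs_sub (h s) (h (s + w))
  linarith [hM s, hM (s + w)]

/-- The dominating function of `(h s - h (s + w)) * w ^ (-1 - θ)` for Hölder continuous `h`. -/
noncomputable def holderBound (θ C κ M w : ℝ) : ℝ :=
  (Ioc 0 1).indicator (fun w => C * w ^ (κ - 1 - θ)) w + 2 * M * (Ioi 1).indicator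
    (fun w => w ^ (-1 - θ)) w

theorem integrableOn_holderBound {C κ M : ℝ} (hθ : 0 < θ) (hκ : θ < κ) :
    IntegrableOn (holderBound θ C κ M) (Ioi 0) := by
  refine Integrable.integrableOn ?_
  refine Integrable.add ?_ (Integrable.const_mul ?_ _)
  · rw [integrable_indicator_iff measurableSet_Ioc]
    refine Integrable.const_mul ?_ _
    have := intervalIntegral.intervalIntegrable_rpow' (a := 0) (b := 1) (r := κ - 1 - θ)
      (by linarith)
    exact (intervalIntegrable_iff_integrableOn_Ioc_of_le zero_le_one).1 this
  · rw [integrable_indicator_iff measurableSet_Ioi]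
    exact integrableOn_Ioi_rpow_of_lt (by linarith) one_pos

theorem bound_of_holder {C κ M : ℝ} (hH : ∀ r s, |h r - h s| ≤ C * |r - s| ^ κ)
    (hM : ∀ s, |h s| ≤ M) (s : ℝ) {w : ℝ} (hw : w ∈ Ioi (0 : ℝ)) :
    |(h s - h (s + w)) * w ^ (-1 - θ)| ≤ holderBound θ C κ M w := by
  have hw0 : 0 < w := hw
  rcases le_or_gt w 1 with h1 | h1
  · rw [holderBound, indicator_of_mem (show w ∈ Ioc 0 1 from ⟨hw0, h1⟩),
      indicator_of_notMem (by simpa using h1), mul_zero, add_zero, abs_mul,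
      abs_of_pos (Real.rpow_pos_of_pos hw0 _)]
    have := hH s (s + w)
    rw [show s - (s + w) = -w by ring, abs_neg, abs_of_pos hw0] at this
    have e : κ - 1 - θ = κ + (-1 - θ) := by ring
    rw [e, Real.rpow_add hw0, ← mul_assoc]
    gcongr
  · rw [holderBound, indicator_of_notMem (by simp [h1]), zero_add,
      indicator_of_mem (show w ∈ Ioi 1 from h1)]
    exact bound_of_bounded le_rfl hM s hw

/-- A Marchaud derivative over a bounded range, completed by the boundary term. -/
theorem div_rpow_add_integral_eq (hθ : 0 < θ) (hε : 0 < ε) {c ℓ M : ℝ} (hℓ : 0 < ℓ) {e : ℝ → ℝ}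
    (he : Measurable e) (hM : ∀ w, |e w| ≤ M) (h0 : ∀ w, ℓ < w → e w = 0) :
    c / ℓ ^ θ + θ * ∫ w in ε..ℓ, (c - e w) / w ^ (1 + θ) =
      θ * ∫ w in Ioi ε, (c - e w) * w ^ (-1 - θ) := by
  have hint : ∀ δ, 0 < δ → IntegrableOn (fun w => (c - e w) * w ^ (-1 - θ)) (Ioi δ) := by
    intro δ hδ
    refine Integrable.mono' (integrableOn_const_mul_rpow_Ioi hθ hδ (|c| + M)) ?_ ?_
    · exact ((measurable_const.sub he).mul (measurable_id.pow_const _)).aestronglyMeasurable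
    · refine (ae_restrict_mem measurableSet_Ioi).mono fun w hw => ?_
      have hw : 0 < w := hδ.trans hw
      rw [Real.norm_eq_abs, abs_mul, abs_of_pos (Real.rpow_pos_of_pos hw _)]
      gcongr
      exact (abs_sub _ _).trans (by linarith [hM w])
  have e1 : ∫ w in ε..ℓ, (c - e w) / w ^ (1 + θ) = ∫ w in ε..ℓ, (c - e w) * w ^ (-1 - θ) := by
    refine intervalIntegral.integral_congr fun w hw => ?_
    have hw : 0 < w := lt_of_lt_of_le (lt_min hε hℓ) hw.1
    rw [div_eq_mul_inv, ← Real.rpow_neg hw.le]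
    congr 2; ring
  -- Beyond ℓ the function e vanishes, and the tail of the integral is exactly the boundary term.
  have e2 : ∫ w in Ioi ℓ, (c - e w) * w ^ (-1 - θ) = c * (ℓ ^ (-θ) / θ) := by
    have : EqOn (fun w => (c - e w) * w ^ (-1 - θ)) (fun w => c * w ^ (-1 - θ)) (Ioi ℓ) :=
      fun w hw => by simp [h0 w hw]
    rw [setIntegral_congr_fun measurableSet_Ioi this, integral_const_mul,
      integral_Ioi_rpow_of_lt (by linarith) hℓ]
    congr 1
    rw [show -1 - θ + 1 = -θ by ring, neg_div_neg_eq]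
  rw [← intervalIntegral.integral_interval_add_Ioi (hint ε hε) (hint ℓ hℓ), e1, e2,
    Real.rpow_neg hℓ.le]
  field_simp
  ring

end

/-! ### The derivative of order θ of the derivative of order 1 - θ, integrated over an interval. -/

section
variable {θ ε m R : ℝ} {q : ℝ → ℝ}

theorem integrableOn_mul_rpow_of_bounded (h0 : 0 < θ) (hq : Continuous q) (hm : ∀ y, |q y| ≤ m)
    (hR : 0 < R) (hqR : ∀ y, R ≤ y → q y = 0) :
    IntegrableOn (fun y => q y * y ^ (θ - 1)) (Ioi 0) := by
  rw [← Ioc_union_Ioi_eq_Ioi hR.le]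
  refine IntegrableOn.union ?_ ?_
  · have := intervalIntegral.intervalIntegrable_rpow' (a := 0) (b := R) (r := θ - 1) (by linarith)
    refine Integrable.bdd_mul (c := m)
      ((intervalIntegrable_iff_integrableOn_Ioc_of_le hR.le).1 this)
      hq.aestronglyMeasurable (ae_of_all _ hm)
  · refine (integrableOn_congr_fun (f := fun _ => (0 : ℝ)) ?_ measurableSet_Ioi).1
      integrableOn_zero
    intro y hy
    simp [hqR y (le_of_lt hy)]

theorem abs_integral_mul_rpow_le (h0 : 0 < θ) (hq : Continuous q) (hm : ∀ y, |q y| ≤ m)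
    (hR : 0 < R) (hqR : ∀ y, R ≤ y → q y = 0) :
    ∫ y in Ioi 0, |q y * y ^ (θ - 1)| ≤ m * (R ^ θ / θ) := by
  have hi : IntegrableOn (fun y => |q y * y ^ (θ - 1)|) (Ioi 0) :=
    (integrableOn_mul_rpow_of_bounded h0 hq hm hR hqR).norm
  have hz : ∀ y ∈ Ioi (0 : ℝ) \ Ioc 0 R, |q y * y ^ (θ - 1)| = 0 := by
    intro y hy
    have : R ≤ y := by
      by_contra hlt
      exact hy.2 ⟨hy.1, (not_le.1 hlt).le⟩
    simp [hqR y this]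
  rw [setIntegral_eq_of_subset_of_forall_sdiff_eq_zero measurableSet_Ioi Ioc_subset_Ioi_self hz]
  have hI := intervalIntegral.intervalIntegrable_rpow' (a := 0) (b := R) (r := θ - 1) (by linarith)
  have hI' := (intervalIntegrable_iff_integrableOn_Ioc_of_le hR.le).1 hI
  calc ∫ y in Ioc 0 R, |q y * y ^ (θ - 1)| ≤ ∫ y in Ioc 0 R, m * y ^ (θ - 1) := by
        refine setIntegral_mono_on (hi.mono_set Ioc_subset_Ioi_self) (hI'.const_mul m)
          measurableSet_Ioc fun y hy => ?_
        rw [abs_mul, abs_of_pos (Real.rpow_pos_of_pos hy.1 _)]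
        have := Real.rpow_pos_of_pos hy.1 (θ - 1)
        gcongr
        exact hm y
    _ = m * (R ^ θ / θ) := by
        rw [integral_const_mul, ← intervalIntegral.integral_of_le hR.le,
          integral_rpow (Or.inl (by linarith))]
        simp [Real.zero_rpow h0.ne']

/-- Integration by parts against -w^(θ-1). The boundary terms vanish because the primitive of q is
O(w) at 0 and bounded at infinity. -/
theorem integral_primitive_mul_rpow (h0 : 0 < θ) (h1 : θ < 1) (hq : Continuous q)
    (hm : ∀ y, |q y| ≤ m) (hR : 0 < R) (hqR : ∀ y, R ≤ y → q y = 0)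
    (hU : IntegrableOn (fun w => (∫ y in 0..w, q y) * w ^ (-1 - (1 - θ))) (Ioi 0)) :
    (1 - θ) * ∫ w in Ioi 0, (∫ y in 0..w, q y) * w ^ (-1 - (1 - θ)) =
      ∫ y in Ioi 0, q y * y ^ (θ - 1) := by
  have hqi := integrableOn_mul_rpow_of_bounded h0 hq hm hR hqR
  have hm0 : 0 ≤ m := (abs_nonneg _).trans (hm 0)
  have hUb : ∀ w, 0 ≤ w → |∫ y in 0..w, q y| ≤ m * w := by
    intro w hw
    have := intervalIntegral.norm_integral_le_of_norm_le_const (a := 0) (b := w) (f := q) (C := m)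
      (fun x _ => hm x)
    simpa [abs_of_nonneg hw] using this
  have hUb' : ∀ w, R ≤ w → |∫ y in 0..w, q y| ≤ m * R := by
    intro w hw
    rw [← intervalIntegral.integral_add_adjacent_intervals (b := R)
      (hq.intervalIntegrable _ _) (hq.intervalIntegrable _ _)]
    have : ∫ y in R..w, q y = 0 := by
      rw [intervalIntegral.integral_congr (g := fun _ => 0)]
      · simp
      · intro y hy
        rw [uIcc_of_le hw] at hy
        exact hqR y hy.1
    rw [this, add_zero]
    exact hUb R hR.le
  have hder : ∀ w ∈ Ioi (0 : ℝ), HasDerivAt (fun w => ∫ y in 0..w, q y) (q w) w := fun w _ =>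
    (hq.integral_hasStrictDerivAt 0 w).hasDerivAt
  have hder' : ∀ w ∈ Ioi (0 : ℝ), HasDerivAt (fun w : ℝ => -w ^ (θ - 1))
      ((1 - θ) * w ^ (-1 - (1 - θ))) w := by
    intro w hw
    have := (Real.hasDerivAt_rpow_const (x := w) (p := θ - 1) (Or.inl (ne_of_gt hw))).neg
    convert! this using 1
    rw [show θ - 1 - 1 = -1 - (1 - θ) by ring]; ring
  have hlim0 : Tendsto ((fun w => ∫ y in 0..w, q y) * fun w : ℝ => -w ^ (θ - 1)) (𝓝[>] 0)
      (𝓝 0) := by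
    have hb : Tendsto (fun w : ℝ => m * w ^ θ) (𝓝[>] 0) (𝓝 0) := by
      have : Tendsto (fun w : ℝ => m * w ^ θ) (𝓝 0) (𝓝 (m * 0 ^ θ)) :=
        ((Real.continuousAt_rpow_const 0 θ (Or.inr h0.le)).const_mul m)
      rw [Real.zero_rpow h0.ne', mul_zero] at this
      exact this.mono_left nhdsWithin_le_nhds
    refine squeeze_zero_norm' ?_ hb
    filter_upwards [self_mem_nhdsWithin] with w hw
    have hw : 0 < w := hw
    rw [Pi.mul_apply, norm_mul, norm_neg, Real.norm_eq_abs, Real.norm_eq_abs,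
      abs_of_pos (Real.rpow_pos_of_pos hw _)]
    calc _ ≤ m * w * w ^ (θ - 1) := by gcongr; exact hUb w hw.le
      _ = m * w ^ θ := by rw [Real.rpow_sub_one hw.ne']; field_simp
  have hlim1 : Tendsto ((fun w => ∫ y in 0..w, q y) * fun w : ℝ => -w ^ (θ - 1)) atTop
      (𝓝 0) := by
    have hb : Tendsto (fun w : ℝ => m * R * w ^ (θ - 1)) atTop (𝓝 0) := by
      have := (tendsto_rpow_neg_atTop (y := 1 - θ) (by linarith)).const_mul (m * R)
      simpa using this
    refine squeeze_zero_norm' ?_ hb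
    filter_upwards [eventually_ge_atTop R] with w hw
    have hw0 : 0 < w := hR.trans_le hw
    rw [Pi.mul_apply, norm_mul, norm_neg, Real.norm_eq_abs, Real.norm_eq_abs,
      abs_of_pos (Real.rpow_pos_of_pos hw0 _)]
    gcongr
    exact hUb' w hw
  have := integral_Ioi_mul_deriv_eq_deriv_mul (a := 0) hder hder' ?_ ?_ hlim0 hlim1
  · rw [← integral_const_mul]
    calc _ = ∫ w in Ioi 0, (∫ y in 0..w, q y) * ((1 - θ) * w ^ (-1 - (1 - θ))) := by
          congr 1; ext w; ring
      _ = _ := by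
          rw [this, sub_zero, zero_sub, ← integral_neg]; simp
  · refine (hU.const_mul (1 - θ)).congr (ae_of_all _ fun w => ?_)
    simp only [Pi.mul_apply]; ring
  · refine hqi.neg.congr (ae_of_all _ fun w => ?_)
    simp

/-- The integrand is the derivative in w of -(z/w - 1)^θ / (θ z), which vanishes at w = z. -/
theorem integral_sub_rpow_mul_rpow (h0 : 0 < θ) {z : ℝ} (hε : 0 < ε) (hz : ε < z) :
    ∫ w in ε..z, (z - w) ^ (θ - 1) * w ^ (-1 - θ) = (z / ε - 1) ^ θ / (θ * z) := by
  have hz0 : 0 < z := hε.trans hz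
  have hcont : ContinuousOn (fun w : ℝ => -((z / w - 1) ^ θ / (θ * z))) (Icc ε z) := by
    refine ContinuousOn.neg (ContinuousOn.div_const (ContinuousOn.rpow_const ?_ ?_) _)
    · refine ContinuousOn.sub (continuousOn_const.div continuousOn_id fun w hw => ?_)
        continuousOn_const
      exact (hε.trans_le hw.1).ne'
    · exact fun _ _ => Or.inr h0.le
  have hder : ∀ w ∈ Ioo ε z, HasDerivAt (fun w : ℝ => -((z / w - 1) ^ θ / (θ * z)))
      ((z - w) ^ (θ - 1) * w ^ (-1 - θ)) w := by
    intro w hw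
    have hw0 : 0 < w := hε.trans hw.1
    have hpos : 0 < z / w - 1 := by rw [sub_pos, one_lt_div hw0]; exact hw.2
    have d1 : HasDerivAt (fun w : ℝ => z / w - 1) (-z / w ^ 2) w := by
      have := ((hasDerivAt_const w z).div (hasDerivAt_id w) hw0.ne').sub_const 1
      convert! this using 1
      simp
    have d2 := ((d1.rpow_const (p := θ) (Or.inl hpos.ne')).div_const (θ * z)).neg
    convert! d2 using 1
    have e : z / w - 1 = (z - w) * w⁻¹ := by field_simp
    rw [e, Real.mul_rpow (by linarith [hw.2]) (by positivity), Real.inv_rpow hw0.le,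
      ← Real.rpow_neg hw0.le]
    have e2 : w ^ (-1 - θ) = w ^ (-(θ - 1)) / w ^ 2 := by
      rw [← Real.rpow_natCast w 2, ← Real.rpow_sub hw0]; congr 1; push_cast; ring
    rw [e2]
    field_simp
  have hi := intervalIntegral.integrableOn_deriv_of_nonneg hcont hder fun w hw =>
    mul_nonneg (Real.rpow_nonneg (by linarith [hw.2]) _)
      (Real.rpow_nonneg (hε.trans hw.1).le _)
  rw [intervalIntegral.integral_eq_sub_of_hasDerivAt_of_le hz.le hcont hder
    ((intervalIntegrable_iff_integrableOn_Ioc_of_le hz.le).2 hi)]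
  simp [div_self hz0.ne', Real.zero_rpow h0.ne']

theorem shift_Ioi (φ : ℝ → ℝ) {w : ℝ} (hw : 0 ≤ w) :
    (IntegrableOn φ (Ioi 0) →
      IntegrableOn ((Ioi w).indicator fun z => φ (z - w)) (Ioi 0)) ∧
    ∫ z in Ioi 0, (Ioi w).indicator (fun z => φ (z - w)) z = ∫ y in Ioi 0, φ y := by
  have e : ((Ioi w).indicator fun z => φ (z - w)) = fun z => (Ioi 0).indicator φ (z - w) := by
    ext z
    simp [indicator, sub_pos]
  constructor
  · intro h
    rw [e]
    exact ((integrable_indicator_iff measurableSet_Ioi).2 h).comp_sub_right w |>.integrableOn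
  · rw [setIntegral_indicator measurableSet_Ioi, inter_eq_right.2 (Ioi_subset_Ioi hw),
      ← integral_indicator measurableSet_Ioi, e, integral_sub_right_eq_self,
      integral_indicator measurableSet_Ioi]

/-- A truncated derivative of order θ nearly inverts a fractional integral of order θ. After the
integrals are exchanged, q(z) is multiplied by ε^(-θ) z^(θ-1) from the unshifted term, minus (z/ε -
1)_+^θ / z from the shifted ones; this is the kernel at scale ε, that is `fracKernel θ (z / ε) / ε`.
-/
theorem integral_fracKernel_eq (h0 : 0 < θ) (hε : 0 < ε) (hq : Continuous q)
    (hm : ∀ y, |q y| ≤ m) (hR : 0 < R) (hqR : ∀ y, R ≤ y → q y = 0) :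
    θ * ∫ w in Ioi ε, ((∫ y in Ioi 0, q y * y ^ (θ - 1)) -
        ∫ y in Ioi 0, q (y + w) * y ^ (θ - 1)) * w ^ (-1 - θ) =
      ∫ z in Ioi 0, q (ε * z) * fracKernel θ z := by
  have hm0 : 0 ≤ m := (abs_nonneg _).trans (hm 0)
  have hqi := integrableOn_mul_rpow_of_bounded h0 hq hm hR hqR
  set A := ∫ y in Ioi 0, q y * y ^ (θ - 1) with hA
  have hqw : ∀ w, Continuous fun y => q (y + w) := fun w => by fun_prop
  have hqwR : ∀ w, 0 ≤ w → ∀ y, R ≤ y → q (y + w) = 0 := fun w hw y hy => hqR _ (by linarith)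
  set f : ℝ → ℝ → ℝ := fun w z =>
    (Ioi w).indicator (fun z => q z * (z - w) ^ (θ - 1)) z * w ^ (-1 - θ) with hf
  have hfz : ∀ w z, (Ioi w).indicator (fun z => q z * (z - w) ^ (θ - 1)) z =
      (Ioi w).indicator (fun z => (fun y => q (y + w) * y ^ (θ - 1)) (z - w)) z := by
    intro w z; simp
  have hfi : ∀ w, 0 < w → IntegrableOn (f w) (Ioi 0) := by
    intro w hw
    simp only [hf, hfz]
    exact ((shift_Ioi _ hw.le).1 (integrableOn_mul_rpow_of_bounded h0 (hqw w) (fun y => hm _) hR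
      (hqwR w hw.le))).mul_const _
  have hfv : ∀ w, 0 < w → ∫ z in Ioi 0, f w z =
      (∫ y in Ioi 0, q (y + w) * y ^ (θ - 1)) * w ^ (-1 - θ) := by
    intro w hw
    simp only [hf, hfz]
    rw [integral_mul_const, (shift_Ioi (fun y => q (y + w) * y ^ (θ - 1)) hw.le).2]
  -- The constant m R^θ / θ does not depend on the shift w, so only w^(-1-θ) has to be integrated
  -- over (ε, ∞), as Fubini's theorem requires.
  have hfn : ∀ w, 0 < w → ∫ z in Ioi 0, ‖f w z‖ ≤ m * (R ^ θ / θ) * w ^ (-1 - θ) := by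
    intro w hw
    have e : ∀ z, ‖f w z‖ = (Ioi w).indicator
        (fun z => (fun y => |q (y + w) * y ^ (θ - 1)|) (z - w)) z * w ^ (-1 - θ) := by
      intro z
      simp only [hf, norm_mul, Real.norm_eq_abs, abs_of_pos (Real.rpow_pos_of_pos hw (-1 - θ))]
      congr 1
      by_cases h : z ∈ Ioi w <;> simp [h, indicator, abs_mul]
    simp only [e]
    rw [integral_mul_const, (shift_Ioi (fun y => |q (y + w) * y ^ (θ - 1)|) hw.le).2]
    gcongr
    exact abs_integral_mul_rpow_le h0 (hqw w) (fun y => hm _) hR (hqwR w hw.le)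
  have hfm : Measurable (Function.uncurry f) := by
    have e : Function.uncurry f = fun p : ℝ × ℝ => ({p : ℝ × ℝ | p.1 < p.2}.indicator
        (fun p => q p.2 * (p.2 - p.1) ^ (θ - 1)) p) * p.1 ^ (-1 - θ) := by
      ext p
      simp [Function.uncurry, hf, indicator]
    rw [e]
    refine Measurable.mul (Measurable.indicator ?_ (measurableSet_lt measurable_fst measurable_snd))
      (measurable_fst.pow_const _)
    exact (hq.measurable.comp measurable_snd).mul
      ((measurable_snd.sub measurable_fst).pow_const _)
  have hint : Integrable (Function.uncurry f)
      ((volume.restrict (Ioi ε)).prod (volume.restrict (Ioi 0))) := by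
    rw [integrable_prod_iff hfm.aestronglyMeasurable]
    refine ⟨(ae_restrict_mem measurableSet_Ioi).mono fun w hw => hfi w (hε.trans hw), ?_⟩
    refine Integrable.mono' (integrableOn_const_mul_rpow_Ioi h0 hε (m * (R ^ θ / θ)))
      hfm.aestronglyMeasurable.norm.integral_prod_right' ?_
    refine (ae_restrict_mem measurableSet_Ioi).mono fun w hw => ?_
    rw [Real.norm_of_nonneg (integral_nonneg fun _ => norm_nonneg _)]
    exact hfn w (hε.trans hw)
  have hinner : ∀ z ∈ Ioi (0 : ℝ), ∫ w in Ioi ε, f w z =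
      q z * ((max (z / ε - 1) 0) ^ θ / (θ * z)) := by
    intro z hz
    have hz : 0 < z := hz
    have e : ∀ w, f w z = (Iio z).indicator
        (fun w => q z * ((z - w) ^ (θ - 1) * w ^ (-1 - θ))) w := by
      intro w
      by_cases h : w < z <;> simp [hf, h, indicator, mul_assoc]
    simp only [e]
    rw [setIntegral_indicator measurableSet_Iio, Ioi_inter_Iio, integral_const_mul]
    congr 1
    rcases le_or_gt z ε with h | h
    · rw [Ioo_eq_empty (not_lt.2 h), max_eq_right]
      · simp [Real.zero_rpow h0.ne']
      · rw [sub_nonpos, div_le_one hε]; exact h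
    · rw [← integral_Ioc_eq_integral_Ioo, ← intervalIntegral.integral_of_le h.le,
        integral_sub_rpow_mul_rpow h0 hε h, max_eq_left]
      rw [sub_nonneg, one_le_div hε]; exact h.le
  have hAi : IntegrableOn (fun w => A * w ^ (-1 - θ)) (Ioi ε) :=
    integrableOn_const_mul_rpow_Ioi h0 hε A
  have hBi : IntegrableOn (fun w => ∫ z in Ioi 0, f w z) (Ioi ε) := hint.integral_prod_left
  have hswap : ∫ w in Ioi ε, ∫ z in Ioi 0, f w z =
      ∫ z in Ioi 0, q z * ((max (z / ε - 1) 0) ^ θ / (θ * z)) := by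
    rw [integral_integral_swap hint, setIntegral_congr_fun measurableSet_Ioi hinner]
  have hBi' : IntegrableOn (fun z => q z * ((max (z / ε - 1) 0) ^ θ / (θ * z))) (Ioi 0) :=
    (integrableOn_congr_fun hinner measurableSet_Ioi).1 hint.integral_prod_right
  calc θ * ∫ w in Ioi ε, (A - ∫ y in Ioi 0, q (y + w) * y ^ (θ - 1)) * w ^ (-1 - θ)
      = θ * ∫ w in Ioi ε, (A * w ^ (-1 - θ) - ∫ z in Ioi 0, f w z) := by
        congr 1
        refine setIntegral_congr_fun measurableSet_Ioi fun w hw => ?_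
        rw [hfv w (hε.trans hw), sub_mul]
    _ = ε ^ (-θ) * A - θ * ∫ z in Ioi 0, q z * ((max (z / ε - 1) 0) ^ θ / (θ * z)) := by
        rw [integral_sub hAi hBi, hswap, integral_const_mul,
          integral_Ioi_rpow_of_lt (by linarith) hε, show -1 - θ + 1 = -θ by ring, neg_div_neg_eq]
        field_simp
    _ = ∫ z in Ioi 0, (ε ^ (-θ) * (q z * z ^ (θ - 1)) -
          θ * (q z * ((max (z / ε - 1) 0) ^ θ / (θ * z)))) := by
        rw [integral_sub (hqi.const_mul _) (hBi'.const_mul _), integral_const_mul,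
          integral_const_mul]
    _ = ∫ z in Ioi 0, ε⁻¹ * (q (ε * (ε⁻¹ * z)) * fracKernel θ (ε⁻¹ * z)) := by
        refine setIntegral_congr_fun measurableSet_Ioi fun z hz => ?_
        have hz : 0 < z := hz
        simp only [fracKernel]
        rw [mul_inv_cancel_left₀ hε.ne', Real.mul_rpow (by positivity) hz.le,
          Real.inv_rpow hε.le, ← Real.rpow_neg hε.le, Real.rpow_sub_one hz.ne',
          show ε⁻¹ * z = z / ε by field_simp]
        field_simp
    _ = ∫ z in Ioi 0, q (ε * z) * fracKernel θ z := by
        rw [integral_const_mul,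
          integral_comp_mul_left_Ioi (fun z => q (ε * z) * fracKernel θ z) 0 (inv_pos.2 hε)]
        rw [mul_zero, inv_inv, smul_eq_mul, inv_mul_cancel_left₀ hε.ne']

end

section
variable {θ ε C κ M b : ℝ} {G : ℝ → ℝ}

theorem continuous_of_holder {h : ℝ → ℝ} (hκ : 0 < κ)
    (hH : ∀ r s, |h r - h s| ≤ C * |r - s| ^ κ) : Continuous h := by
  rw [continuous_iff_continuousAt]
  intro s
  rw [ContinuousAt, tendsto_iff_dist_tendsto_zero]
  have hlim : Tendsto (fun r => C * |r - s| ^ κ) (𝓝 s) (𝓝 0) := by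
    have hc : Continuous fun r => C * |r - s| ^ κ :=
      continuous_const.mul ((by fun_prop : Continuous fun r => |r - s|).rpow_const
        fun _ => Or.inr hκ.le)
    have := hc.tendsto s
    simpa [Real.zero_rpow hκ.ne'] using this
  exact squeeze_zero (fun _ => dist_nonneg) (fun r => hH r s) hlim

/-- Both sides are the integral of G over [u, u + w] minus that over [v, v + w]. The right side
involves G only through its increments across translates of [u, v]. -/
theorem integral_sub_shift {G : ℝ → ℝ} (hG : Continuous G) (u v w : ℝ) :
    ∫ s in u..v, (G s - G (s + w)) = ∫ y in 0..w, (G (u + y) - G (v + y)) := by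
  have hi : ∀ a c, IntervalIntegrable G volume a c := fun a c => hG.intervalIntegrable a c
  rw [intervalIntegral.integral_sub (hi _ _)
      ((by fun_prop : Continuous fun s => G (s + w)).intervalIntegrable _ _),
    intervalIntegral.integral_sub
      ((by fun_prop : Continuous fun y => G (u + y)).intervalIntegrable _ _)
      ((by fun_prop : Continuous fun y => G (v + y)).intervalIntegrable _ _),
    intervalIntegral.integral_comp_add_right, intervalIntegral.integral_comp_add_left,
    intervalIntegral.integral_comp_add_left, add_zero, add_zero]
  have e1 := intervalIntegral.integral_add_adjacent_intervals (hi u v) (hi v (v + w))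
  have e2 := intervalIntegral.integral_add_adjacent_intervals (hi u (u + w)) (hi (u + w) (v + w))
  linarith

/-- Integrated over [u, v], the derivative of order 1 - θ becomes a fractional integral of order θ
of the increments of G. -/
theorem integral_marchaud_zero (h0 : 0 < θ) (h1 : θ < 1) (hκ : 1 - θ < κ) (hb : 0 < b)
    (hH : ∀ r s, |G r - G s| ≤ C * |r - s| ^ κ) (hM : ∀ r, |G r| ≤ M)
    (hGb : ∀ r, b ≤ r → G r = 0) {u v : ℝ} (hu : 0 ≤ u) (huv : u ≤ v) :
    ∫ s in u..v, marchaud (1 - θ) 0 G s =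
      1 / Real.Gamma θ * ∫ y in Ioi 0, (G (u + y) - G (v + y)) * y ^ (θ - 1) := by
  have hG := continuous_of_holder (by linarith) hH
  obtain ⟨hi, hv⟩ := integral_marchaud (θ := 1 - θ) hG
    (integrableOn_holderBound (by linarith) hκ)
    (fun s w hw => bound_of_holder hH hM s hw) huv
  simp only [integral_sub_shift hG] at hi hv
  have hq : Continuous fun y => G (u + y) - G (v + y) := by fun_prop
  have := integral_primitive_mul_rpow (m := 2 * M) h0 h1 hq
    (fun y => (abs_sub _ _).trans (by linarith [hM (u + y), hM (v + y)])) hb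
    (fun y hy => by rw [hGb _ (by linarith), hGb _ (by linarith), sub_zero]) hi
  rw [hv, ← this, show 1 - (1 - θ) = θ by ring]
  ring

theorem integral_marchaud_marchaud (h0 : 0 < θ) (h1 : θ < 1) (hκ : 1 - θ < κ) (hb : 0 < b)
    (hε : 0 < ε) (hH : ∀ r s, |G r - G s| ≤ C * |r - s| ^ κ) (hM : ∀ r, |G r| ≤ M)
    (hGb : ∀ r, b ≤ r → G r = 0) {u v : ℝ} (hu : 0 ≤ u) (huv : u ≤ v) :
    ∫ s in u..v, marchaud θ ε (marchaud (1 - θ) 0 G) s =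
      (Real.Gamma θ * Real.Gamma (1 - θ))⁻¹ *
        ∫ z in Ioi 0, (G (u + ε * z) - G (v + ε * z)) * fracKernel θ z := by
  have hG := continuous_of_holder (by linarith) hH
  obtain ⟨hψ, K, hK0, hK⟩ := marchaud_regular (θ := 1 - θ) hG
    (integrableOn_holderBound (by linarith) hκ) (fun s w hw => bound_of_holder hH hM s hw)
  obtain ⟨-, hv⟩ := integral_marchaud (θ := θ) hψ (integrableOn_const_mul_rpow_Ioi h0 hε (2 * K))
    (fun s w hw => bound_of_bounded hε.le hK s hw) huv
  have hq : Continuous fun y => G (u + y) - G (v + y) := by fun_prop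
  have hker := integral_fracKernel_eq (m := 2 * M) h0 hε hq
    (fun y => (abs_sub _ _).trans (by linarith [hM (u + y), hM (v + y)])) hb
    (fun y hy => by rw [hGb _ (by linarith), hGb _ (by linarith), sub_zero])
  rw [hv, ← hker]
  have hin : ∀ w ∈ Ioi ε,
      (∫ s in u..v, (marchaud (1 - θ) 0 G s - marchaud (1 - θ) 0 G (s + w))) * w ^ (-1 - θ) =
      1 / Real.Gamma θ * (((∫ y in Ioi 0, (G (u + y) - G (v + y)) * y ^ (θ - 1)) -
        ∫ y in Ioi 0, (G (u + (y + w)) - G (v + (y + w))) * y ^ (θ - 1)) * w ^ (-1 - θ)) := by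
    intro w hw
    have hw : 0 < w := hε.trans hw
    rw [intervalIntegral.integral_sub (hψ.intervalIntegrable _ _)
      ((by fun_prop : Continuous fun s => marchaud (1 - θ) 0 G (s + w)).intervalIntegrable _ _),
      intervalIntegral.integral_comp_add_right,
      integral_marchaud_zero h0 h1 hκ hb hH hM hGb hu huv,
      integral_marchaud_zero h0 h1 hκ hb hH hM hGb (add_nonneg hu hw.le) (by linarith)]
    simp only [add_assoc, add_comm w]
    ring
  rw [setIntegral_congr_fun measurableSet_Ioi hin, integral_const_mul]
  field_simp

/-- The integral is an average, for a nonnegative kernel normalized to mass 1, of increments of G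
over translates of [u, v]. The point is that the bound does not depend on ε. -/
theorem abs_integral_marchaud_marchaud_le (h0 : 0 < θ) (h1 : θ < 1) (hκ : 1 - θ < κ) (hb : 0 < b)
    (hε : 0 < ε) (hH : ∀ r s, |G r - G s| ≤ C * |r - s| ^ κ) (hM : ∀ r, |G r| ≤ M)
    (hGb : ∀ r, b ≤ r → G r = 0) {u v : ℝ} (hu : 0 ≤ u) (huv : u ≤ v) :
    |∫ s in u..v, marchaud θ ε (marchaud (1 - θ) 0 G) s| ≤ C * (v - u) ^ κ := by
  obtain ⟨hKi, hKv⟩ := integrableOn_and_integral_fracKernel h0 h1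
  have hΓ : 0 < Real.Gamma θ * Real.Gamma (1 - θ) :=
    mul_pos (Real.Gamma_pos_of_pos h0) (Real.Gamma_pos_of_pos (by linarith))
  rw [integral_marchaud_marchaud h0 h1 hκ hb hε hH hM hGb hu huv, abs_mul,
    abs_of_pos (inv_pos.2 hΓ), inv_mul_le_iff₀ hΓ, ← hKv, mul_comm, ← integral_const_mul, ← Real.norm_eq_abs]
  refine norm_integral_le_of_norm_le (hKi.const_mul _) ?_
  refine (ae_restrict_mem measurableSet_Ioi).mono fun z hz => ?_
  rw [norm_mul, Real.norm_eq_abs, Real.norm_of_nonneg (fracKernel_nonneg h0 hz)]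
  have := hH (u + ε * z) (v + ε * z)
  rw [show u + ε * z - (v + ε * z) = -(v - u) by ring, abs_neg,
    abs_of_nonneg (sub_nonneg.2 huv)] at this
  exact mul_le_mul_of_nonneg_right this (fracKernel_nonneg h0 hz)

theorem tendsto_integral_marchaud_marchaud (h0 : 0 < θ) (h1 : θ < 1) (hκ : 1 - θ < κ)
    (hb : 0 < b) (hH : ∀ r s, |G r - G s| ≤ C * |r - s| ^ κ) (hM : ∀ r, |G r| ≤ M)
    (hGb : ∀ r, b ≤ r → G r = 0) {u v : ℝ} (hu : 0 ≤ u) (huv : u ≤ v) :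
    Tendsto (fun ε => ∫ s in u..v, marchaud θ ε (marchaud (1 - θ) 0 G) s) (𝓝[>] 0)
      (𝓝 (G u - G v)) := by
  have hG := continuous_of_holder (by linarith) hH
  obtain ⟨hKi, hKv⟩ := integrableOn_and_integral_fracKernel h0 h1
  have hΓ : 0 < Real.Gamma θ * Real.Gamma (1 - θ) :=
    mul_pos (Real.Gamma_pos_of_pos h0) (Real.Gamma_pos_of_pos (by linarith))
  have hmain : Tendsto (fun ε => (Real.Gamma θ * Real.Gamma (1 - θ))⁻¹ *
      ∫ z in Ioi 0, (G (u + ε * z) - G (v + ε * z)) * fracKernel θ z) (𝓝[>] 0)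
      (𝓝 ((Real.Gamma θ * Real.Gamma (1 - θ))⁻¹ *
        ∫ z in Ioi 0, (G u - G v) * fracKernel θ z)) := by
    refine Tendsto.const_mul _ ?_
    refine tendsto_integral_filter_of_dominated_convergence
      (fun z => 2 * M * fracKernel θ z) ?_ ?_ (hKi.const_mul _) ?_
    · refine Eventually.of_forall fun ε => ?_
      exact (by fun_prop : Continuous fun z => G (u + ε * z) - G (v + ε * z)).aestronglyMeasurable.mul
        hKi.aestronglyMeasurable
    · refine Eventually.of_forall fun ε => ?_
      refine (ae_restrict_mem measurableSet_Ioi).mono fun z hz => ?_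
      rw [norm_mul, Real.norm_eq_abs, Real.norm_of_nonneg (fracKernel_nonneg h0 hz)]
      refine mul_le_mul_of_nonneg_right ?_ (fracKernel_nonneg h0 hz)
      exact (abs_sub _ _).trans (by linarith [hM (u + ε * z), hM (v + ε * z)])
    · refine ae_of_all _ fun z => Tendsto.mul_const _ ?_
      have hc : Continuous fun ε => G (u + ε * z) - G (v + ε * z) := by fun_prop
      have := (hc.tendsto 0).mono_left (nhdsWithin_le_nhds (s := Ioi 0))
      simpa using this
  rw [integral_const_mul, hKv, mul_comm (G u - G v), inv_mul_cancel_left₀ hΓ.ne'] at hmain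
  refine hmain.congr' ?_
  filter_upwards [self_mem_nhdsWithin] with ε hε
  exact (integral_marchaud_marchaud h0 h1 hκ hb hε hH hM hGb hu huv).symm

end

/-! ### The fractional derivatives of the definition, and integration by parts. -/

section
variable {θ ε b M : ℝ} {f g G : ℝ → ℝ}

/-- The substitution r = s - w and the extension of f by 0 absorb the boundary term into an integral
over (ε, ∞). The orientation of the truncated integral makes this hold for s < ε as well. -/
theorem leftFracDerivTrunc_eq (hθ : 0 < θ) (hε : 0 < ε)
    (hf : Measurable ((Icc 0 b).indicator f)) (hM : ∀ r, |(Icc 0 b).indicator f r| ≤ M)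
    {s : ℝ} (hs : s ∈ Ioo 0 b) :
    leftFracDerivTrunc θ 0 b ε f s = θ / Real.Gamma (1 - θ) *
      ∫ w in Ioi ε, ((Icc 0 b).indicator f s - (Icc 0 b).indicator f (s - w)) * w ^ (-1 - θ) := by
  have hfs : (Icc 0 b).indicator f s = f s := indicator_of_mem (Ioo_subset_Icc_self hs) f
  have key := div_rpow_add_integral_eq (θ := θ) (ε := ε) hθ hε (c := f s) (ℓ := s) hs.1
    (e := fun w => (Icc 0 b).indicator f (s - w)) (M := M)
    (hf.comp (measurable_const.sub measurable_id)) (fun w => hM _)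
    (fun w hw => indicator_of_notMem (fun h => by linarith [h.1]) _)
  have hsub := intervalIntegral.integral_comp_sub_left (a := ε) (b := s)
    (fun r => (f s - (Icc 0 b).indicator f r) / (s - r) ^ (1 + θ)) s
  simp only [sub_sub_cancel, sub_self] at hsub
  rw [leftFracDerivTrunc, ← hsub, sub_zero, key, hfs]
  ring

theorem rightFracDerivTrunc_eq (hθ : 0 < θ) (hε : 0 < ε) (hG : Continuous G)
    (hM : ∀ r, |G r| ≤ M) (hGb : ∀ r, b ≤ r → G r = 0) (hfG : EqOn f G (Icc 0 b))
    {r : ℝ} (hr : r ∈ Ioo 0 b) :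
    rightFracDerivTrunc θ 0 b ε f r = marchaud θ ε G r := by
  have hfr : f r = G r := hfG (Ioo_subset_Icc_self hr)
  have key := div_rpow_add_integral_eq (θ := θ) (ε := ε) hθ hε (c := G r) (ℓ := b - r)
    (sub_pos.2 hr.2) (e := fun w => G (r + w)) (M := M)
    (hG.measurable.comp (measurable_const.add measurable_id)) (fun w => hM _)
    (fun w hw => hGb _ (by linarith))
  have hsub := intervalIntegral.integral_comp_add_left (a := ε) (b := b - r)
    (fun s => (f r - (Icc 0 b).indicator f s) / (s - r) ^ (1 + θ)) r
  simp only [add_sub_cancel_left, add_sub_cancel] at hsub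
  have hcongr : ∫ w in ε..(b - r), (f r - (Icc 0 b).indicator f (r + w)) / w ^ (1 + θ) =
      ∫ w in ε..(b - r), (G r - G (r + w)) / w ^ (1 + θ) := by
    refine intervalIntegral.integral_congr fun w hw => ?_
    have hw : 0 < w := lt_of_lt_of_le (lt_min hε (sub_pos.2 hr.2)) hw.1
    have : (Icc 0 b).indicator f (r + w) = G (r + w) := by
      by_cases h : r + w ≤ b
      · have hmem : r + w ∈ Icc 0 b := ⟨by linarith [hr.1], h⟩
        rw [indicator_of_mem hmem, hfG hmem]
      · rw [indicator_of_notMem (fun h' => h h'.2), hGb _ (not_le.1 h).le]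
    simp only [this, hfr]
  rw [rightFracDerivTrunc, ← hsub, hcongr, hfr, key, marchaud]
  ring

/-- Convergence in norm gives almost everywhere convergence along a sequence ε → 0, so the two
limits agree. -/
theorem ae_eq_of_tendsto_eLpNorm {μ : Measure ℝ} {p : ℝ≥0∞} (hp : p ≠ 0) {D : ℝ → ℝ → ℝ}
    {φ ψ : ℝ → ℝ} (hD : ∀ ε, 0 < ε → AEStronglyMeasurable (D ε) μ)
    (hφ : AEStronglyMeasurable φ μ)
    (hlim : Tendsto (fun ε => eLpNorm (fun t => D ε t - φ t) p μ) (𝓝[>] 0) (𝓝 0))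
    (hae : ∀ᵐ t ∂μ, Tendsto (fun ε => D ε t) (𝓝[>] 0) (𝓝 (ψ t))) : φ =ᵐ[μ] ψ := by
  have hseq : Tendsto (fun n : ℕ => 1 / ((n : ℝ) + 1)) atTop (𝓝[>] 0) := by
    refine tendsto_nhdsWithin_iff.2 ⟨tendsto_one_div_add_atTop_nhds_zero_nat, ?_⟩
    exact Eventually.of_forall fun n => by simp only [mem_Ioi]; positivity
  have hmeas := tendstoInMeasure_of_tendsto_eLpNorm (l := atTop) (μ := μ) hp
    (f := fun n : ℕ => D (1 / ((n : ℝ) + 1)))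
    (fun n => hD _ (by positivity)) hφ (hlim.comp hseq)
  obtain ⟨ns, hns, hlim'⟩ := hmeas.exists_seq_tendsto_ae
  filter_upwards [hlim', hae] with t h1 h2
  exact tendsto_nhds_unique h1 (h2.comp (hseq.comp hns.tendsto_atTop))

theorem tendsto_marchaud {D : ℝ → ℝ} (hG : Continuous G) (hD : IntegrableOn D (Ioi 0))
    (hbd : ∀ s, ∀ w ∈ Ioi (0 : ℝ), |(G s - G (s + w)) * w ^ (-1 - θ)| ≤ D w) (s : ℝ) :
    Tendsto (fun ε => marchaud θ ε G s) (𝓝[>] 0) (𝓝 (marchaud θ 0 G s)) := by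
  have hm : Measurable (fun w => (G s - G (s + w)) * w ^ (-1 - θ)) :=
    ((measurable_const.sub (hG.measurable.comp (measurable_const.add measurable_id))).mul
      (measurable_id.pow_const _))
  have e : ∀ ε, 0 ≤ ε → ∫ w in Ioi ε, (G s - G (s + w)) * w ^ (-1 - θ) =
      ∫ w in Ioi 0, (Ioi ε).indicator (fun w => (G s - G (s + w)) * w ^ (-1 - θ)) w := by
    intro ε hε
    rw [setIntegral_indicator measurableSet_Ioi, inter_eq_right.2 (Ioi_subset_Ioi hε)]
  refine Tendsto.const_mul _ ?_
  have : Tendsto (fun ε => ∫ w in Ioi 0,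
      (Ioi ε).indicator (fun w => (G s - G (s + w)) * w ^ (-1 - θ)) w) (𝓝[>] 0)
      (𝓝 (∫ w in Ioi 0, (G s - G (s + w)) * w ^ (-1 - θ))) := by
    refine tendsto_integral_filter_of_dominated_convergence D ?_ ?_ hD ?_
    · exact Eventually.of_forall fun ε => (hm.indicator measurableSet_Ioi).aestronglyMeasurable
    · refine Eventually.of_forall fun ε => ?_
      refine (ae_restrict_mem measurableSet_Ioi).mono fun w hw => ?_
      exact (norm_indicator_le_norm_self _ _).trans (hbd s w hw)
    · refine (ae_restrict_mem measurableSet_Ioi).mono fun w hw => ?_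
      refine tendsto_const_nhds.congr' ?_
      filter_upwards [Ioo_mem_nhdsGT (show (0 : ℝ) < w from hw)] with ε hε
      rw [indicator_of_mem (show w ∈ Ioi ε from hε.2)]
  refine this.congr' ?_
  filter_upwards [self_mem_nhdsWithin] with ε hε
  exact (e ε (le_of_lt hε)).symm

/-- Fractional integration by parts for the truncated derivatives. -/
theorem integral_leftFracDerivTrunc_mul (hθ : 0 < θ) (hε : 0 < ε)
    (hf : Measurable ((Icc 0 b).indicator f)) (hM : ∀ r, |(Icc 0 b).indicator f r| ≤ M)
    {ψ : ℝ → ℝ} {K : ℝ} (hψ : Continuous ψ) (hK : ∀ r, |ψ r| ≤ K) (hψb : ∀ r, b ≤ r → ψ r = 0) :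
    ∫ s in Icc 0 b, leftFracDerivTrunc θ 0 b ε f s * ψ s =
      ∫ s in Icc 0 b, f s * marchaud θ ε ψ s := by
  set F := (Icc 0 b).indicator f with hF
  have hM0 : 0 ≤ M := (abs_nonneg _).trans (hM 0)
  have hK0 : 0 ≤ K := (abs_nonneg _).trans (hK 0)
  have hFm : Measurable F := hf
  have hψm := hψ.measurable
  set c := θ / Real.Gamma (1 - θ) with hc
  have hdom : Integrable (fun p : ℝ × ℝ => 2 * M * K * p.2 ^ (-1 - θ))
      ((volume.restrict (Icc 0 b)).prod (volume.restrict (Ioi ε))) :=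
    Integrable.comp_snd (integrableOn_const_mul_rpow_Ioi hθ hε (2 * M * K)) _
  have hmem : ∀ᵐ p : ℝ × ℝ ∂((volume.restrict (Icc 0 b)).prod (volume.restrict (Ioi ε))),
      p ∈ Icc 0 b ×ˢ Ioi ε := by
    rw [Measure.prod_restrict]
    exact ae_restrict_mem (measurableSet_Icc.prod measurableSet_Ioi)
  have hbound : ∀ x y w : ℝ, |x| ≤ 2 * M → |y| ≤ K → w ∈ Ioi ε →
      ‖x * y * w ^ (-1 - θ)‖ ≤ 2 * M * K * w ^ (-1 - θ) := by
    intro x y w hx hy hw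
    have hw : 0 < w := hε.trans hw
    rw [norm_mul, norm_mul, Real.norm_eq_abs, Real.norm_eq_abs, Real.norm_eq_abs,
      abs_of_pos (Real.rpow_pos_of_pos hw _)]
    gcongr
  have hint1 : Integrable (fun p : ℝ × ℝ => (F p.1 - F (p.1 - p.2)) * ψ p.1 * p.2 ^ (-1 - θ))
      ((volume.restrict (Icc 0 b)).prod (volume.restrict (Ioi ε))) := by
    refine Integrable.mono' hdom ?_ ?_
    · exact ((((hFm.comp measurable_fst).sub (hFm.comp (measurable_fst.sub measurable_snd))).mul
        (hψm.comp measurable_fst)).mul (measurable_snd.pow_const _)).aestronglyMeasurable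
    · filter_upwards [hmem] with p hp
      refine hbound _ _ _ ?_ (hK _) hp.2
      exact (abs_sub _ _).trans (by linarith [hM p.1, hM (p.1 - p.2)])
  have hint2 : Integrable (fun p : ℝ × ℝ => (ψ p.1 - ψ (p.1 + p.2)) * F p.1 * p.2 ^ (-1 - θ))
      ((volume.restrict (Icc 0 b)).prod (volume.restrict (Ioi ε))) := by
    refine Integrable.mono' hdom ?_ ?_
    · exact ((((hψm.comp measurable_fst).sub (hψm.comp (measurable_fst.add measurable_snd))).mul
        (hFm.comp measurable_fst)).mul (measurable_snd.pow_const _)).aestronglyMeasurable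
    · filter_upwards [hmem] with p hp
      have hw : 0 < p.2 := hε.trans hp.2
      rw [norm_mul, norm_mul, Real.norm_eq_abs, Real.norm_eq_abs, Real.norm_eq_abs,
        abs_of_pos (Real.rpow_pos_of_pos hw _)]
      have h1 : |ψ p.1 - ψ (p.1 + p.2)| ≤ 2 * K :=
        (abs_sub _ _).trans (by linarith [hK p.1, hK (p.1 + p.2)])
      calc _ ≤ 2 * K * M * p.2 ^ (-1 - θ) := by gcongr; exact hM _
        _ = _ := by ring
  have hbdd : ∀ {h : ℝ → ℝ} {B : ℝ}, Measurable h → (∀ s, |h s| ≤ B) →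
      IntegrableOn h (Icc 0 b) := fun hh hB =>
    Integrable.of_bound hh.aestronglyMeasurable _ (ae_of_all _ hB)
  have hinner : ∀ w ∈ Ioi ε, ∫ s in Icc 0 b, (F s - F (s - w)) * ψ s * w ^ (-1 - θ) =
      ∫ s in Icc 0 b, (ψ s - ψ (s + w)) * F s * w ^ (-1 - θ) := by
    intro w hw
    have hw : 0 < w := hε.trans hw
    rw [integral_mul_const, integral_mul_const]
    congr 1
    have i1 : IntegrableOn (fun s => F s * ψ s) (Icc 0 b) :=
      hbdd (B := M * K) (hFm.mul hψm) fun s => by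
        rw [abs_mul]; exact mul_le_mul (hM _) (hK _) (abs_nonneg _) hM0
    have i2 : IntegrableOn (fun s => F (s - w) * ψ s) (Icc 0 b) :=
      hbdd (B := M * K) ((hFm.comp (measurable_id.sub_const w)).mul hψm) fun s => by
        rw [abs_mul]; exact mul_le_mul (hM _) (hK _) (abs_nonneg _) hM0
    have i3 : IntegrableOn (fun s => F s * ψ (s + w)) (Icc 0 b) :=
      hbdd (B := M * K) (hFm.mul (hψm.comp (measurable_id.add_const w))) fun s => by
        rw [abs_mul]; exact mul_le_mul (hM _) (hK _) (abs_nonneg _) hM0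
    -- Translation by w leaves no boundary terms, because F vanishes on the negative half-line and ψ
    -- on [b, ∞).
    have hshift : ∫ s in Icc 0 b, F (s - w) * ψ s = ∫ s in Icc 0 b, F s * ψ (s + w) := by
      rw [setIntegral_eq_integral_of_forall_compl_eq_zero,
        setIntegral_eq_integral_of_forall_compl_eq_zero,
        ← integral_sub_right_eq_self (fun s => F s * ψ (s + w)) w]
      · simp
      · intro s hs
        rw [hF, indicator_of_notMem hs, zero_mul]
      · intro s hs
        by_cases h : 0 ≤ s
        · rw [hψb s (le_of_lt (not_le.1 fun h' => hs ⟨h, h'⟩)), mul_zero]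
        · rw [hF, indicator_of_notMem (fun h' => h (by linarith [h'.1])), zero_mul]
    calc ∫ s in Icc 0 b, (F s - F (s - w)) * ψ s
        = ∫ s in Icc 0 b, (F s * ψ s - F (s - w) * ψ s) := by simp only [sub_mul]
      _ = ∫ s in Icc 0 b, (F s * ψ s - F s * ψ (s + w)) := by
          rw [integral_sub i1 i2, integral_sub i1 i3, hshift]
      _ = _ := by congr 1; ext s; ring
  have hL : ∫ s in Icc 0 b, leftFracDerivTrunc θ 0 b ε f s * ψ s =
      c * ∫ s in Icc 0 b, ∫ w in Ioi ε, (F s - F (s - w)) * ψ s * w ^ (-1 - θ) := by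
    rw [← integral_const_mul, integral_Icc_eq_integral_Ioo, integral_Icc_eq_integral_Ioo]
    refine setIntegral_congr_fun measurableSet_Ioo fun s hs => ?_
    rw [leftFracDerivTrunc_eq hθ hε hf hM hs, mul_assoc, ← integral_mul_const]
    congr 2; ext w; ring
  have hR : ∫ s in Icc 0 b, f s * marchaud θ ε ψ s =
      c * ∫ s in Icc 0 b, ∫ w in Ioi ε, (ψ s - ψ (s + w)) * F s * w ^ (-1 - θ) := by
    rw [← integral_const_mul]
    refine setIntegral_congr_fun measurableSet_Icc fun s hs => ?_
    have : F s = f s := indicator_of_mem hs f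
    simp only [marchaud]
    rw [← this, mul_left_comm, ← integral_const_mul]
    congr 2; ext w; ring
  rw [hL, hR]
  congr 1
  refine (integral_integral_swap hint1).trans (Eq.trans ?_ (integral_integral_swap hint2).symm)
  exact setIntegral_congr_fun measurableSet_Ioi hinner

end

section
variable {θ b κ C M I : ℝ} {f g : ℝ → ℝ}

/-- `g - g b`, extended from `[0, b]` to the line by constants. -/
noncomputable def clipSub (b : ℝ) (g : ℝ → ℝ) (r : ℝ) : ℝ := g (max 0 (min r b)) - g b

theorem clipSub_holder (hb : 0 < b) (hκ : 0 < κ)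
    (hg : ∀ r ∈ Icc 0 b, ∀ s ∈ Icc 0 b, |g r - g s| ≤ C * |r - s| ^ κ) :
    0 ≤ C ∧ (∀ r s, |clipSub b g r - clipSub b g s| ≤ C * |r - s| ^ κ) ∧
      (∀ r, |clipSub b g r| ≤ C * b ^ κ) ∧ (∀ r, b ≤ r → clipSub b g r = 0) ∧
      EqOn (clipSub b g) (fun r => g r - g b) (Icc 0 b) := by
  have hmem : ∀ r, max 0 (min r b) ∈ Icc 0 b := fun r =>
    ⟨le_max_left _ _, max_le hb.le (min_le_right _ _)⟩
  have hC : 0 ≤ C := by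
    have := (abs_nonneg _).trans (hg 0 ⟨le_rfl, hb.le⟩ b ⟨hb.le, le_rfl⟩)
    rw [zero_sub, abs_neg, abs_of_pos hb] at this
    exact nonneg_of_mul_nonneg_left this (Real.rpow_pos_of_pos hb κ)
  have hlip : ∀ r s, |max 0 (min r b) - max 0 (min s b)| ≤ |r - s| := fun r s => by
    have h1 := abs_max_sub_max_le_abs (min r b) (min s b) 0
    have h2 := abs_min_sub_min_le_max r b s b
    rw [sub_self, abs_zero, max_eq_left (abs_nonneg _)] at h2
    rw [max_comm 0, max_comm 0]
    exact h1.trans h2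
  refine ⟨hC, fun r s => ?_, fun r => ?_, fun r hr => ?_, fun r hr => ?_⟩
  · simp only [clipSub, sub_sub_sub_cancel_right]
    refine (hg _ (hmem r) _ (hmem s)).trans ?_
    exact mul_le_mul_of_nonneg_left (Real.rpow_le_rpow (abs_nonneg _) (hlip r s) hκ.le) hC
  · refine (hg _ (hmem r) b ⟨hb.le, le_rfl⟩).trans ?_
    gcongr
    rw [abs_sub_comm, abs_of_nonneg (sub_nonneg.2 (hmem r).2)]
    linarith [(hmem r).1]
  · simp [clipSub, min_eq_right hr, max_eq_right hb.le]
  · simp [clipSub, min_eq_left hr.2, max_eq_right hr.1]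

theorem aestronglyMeasurable_leftFracDerivTrunc {ε : ℝ} (hθ : 0 < θ) (hε : 0 < ε)
    (hf : Measurable ((Icc 0 b).indicator f)) (hM : ∀ r, |(Icc 0 b).indicator f r| ≤ M) :
    AEStronglyMeasurable (leftFracDerivTrunc θ 0 b ε f) (volume.restrict (Icc 0 b)) ∧
      ∃ K, ∀ᵐ s ∂(volume.restrict (Icc 0 b)), |leftFracDerivTrunc θ 0 b ε f s| ≤ K := by
  rw [← restrict_Ioo_eq_restrict_Icc]
  set F := (Icc 0 b).indicator f with hF
  have heq : ∀ᵐ s ∂(volume.restrict (Ioo 0 b)), θ / Real.Gamma (1 - θ) *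
      ∫ w in Ioi ε, (F s - F (s - w)) * w ^ (-1 - θ) = leftFracDerivTrunc θ 0 b ε f s :=
    (ae_restrict_mem measurableSet_Ioo).mono fun s hs => (leftFracDerivTrunc_eq hθ hε hf hM hs).symm
  constructor
  · refine AEStronglyMeasurable.congr ?_ heq
    refine AEStronglyMeasurable.const_mul ?_ _
    refine StronglyMeasurable.aestronglyMeasurable ?_
    refine StronglyMeasurable.integral_prod_right (f := fun s w =>
      (F s - F (s - w)) * w ^ (-1 - θ)) ?_
    exact (((hf.comp measurable_fst).sub (hf.comp (measurable_fst.sub measurable_snd))).mul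
      (measurable_snd.pow_const _)).stronglyMeasurable
  · refine ⟨|θ / Real.Gamma (1 - θ)| * ∫ w in Ioi ε, 2 * M * w ^ (-1 - θ), ?_⟩
    filter_upwards [heq] with s hs
    rw [← hs, abs_mul]
    gcongr
    rw [← Real.norm_eq_abs]
    refine norm_integral_le_of_norm_le (integrableOn_const_mul_rpow_Ioi hθ hε (2 * M)) ?_
    refine (ae_restrict_mem measurableSet_Ioi).mono fun w hw => ?_
    have hw : 0 < w := hε.trans hw
    rw [Real.norm_eq_abs, abs_mul, abs_of_pos (Real.rpow_pos_of_pos hw _)]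
    gcongr
    exact (abs_sub _ _).trans (by linarith [hM s, hM (s - w)])

theorem HasLeftFracDeriv.tendsto_integral_mul {p : ℝ≥0∞} {φ ψ : ℝ → ℝ} {K : ℝ} (hθ : 0 < θ)
    (hp : 1 ≤ p)
    (hf : Measurable ((Icc 0 b).indicator f)) (hM : ∀ r, |(Icc 0 b).indicator f r| ≤ M)
    (hφ : HasLeftFracDeriv θ p 0 b f φ) (hψ : Continuous ψ) (hK : ∀ r, |ψ r| ≤ K) :
    Tendsto (fun ε => ∫ s in Icc 0 b, leftFracDerivTrunc θ 0 b ε f s * ψ s) (𝓝[>] 0)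
      (𝓝 (∫ s in Icc 0 b, φ s * ψ s)) := by
  obtain ⟨-, hφm, hlim⟩ := hφ
  have hreg := fun ε (hε : 0 < ε) => aestronglyMeasurable_leftFracDerivTrunc (b := b) hθ hε hf hM
  refine tendsto_integral_of_L1' _ (hφm.1.mul hψ.aestronglyMeasurable) ?_ ?_
  · filter_upwards [self_mem_nhdsWithin] with ε hε
    obtain ⟨h1, K', h2⟩ := hreg ε hε
    have hK'int : IntegrableOn (leftFracDerivTrunc θ 0 b ε f) (Icc 0 b) :=
      Integrable.of_bound h1 K' h2
    refine (Integrable.bdd_mul (c := K) hK'int hψ.aestronglyMeasurable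
      (ae_of_all _ hK)).congr (ae_of_all _ fun s => ?_)
    simp only; ring
  · have hlim1 : Tendsto (fun ε => ENNReal.ofReal K *
        (eLpNorm (fun t => leftFracDerivTrunc θ 0 b ε f t - φ t) p (volume.restrict (Icc 0 b)) *
          (volume.restrict (Icc 0 b)) univ ^ (1 / (1 : ℝ≥0∞).toReal - 1 / p.toReal)))
        (𝓝[>] 0) (𝓝 0) := by
      have hfin : (volume.restrict (Icc 0 b)) univ ^ (1 / (1 : ℝ≥0∞).toReal - 1 / p.toReal) ≠ ∞ := by
        refine ENNReal.rpow_ne_top_of_nonneg ?_ (measure_ne_top _ _)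
        rw [ENNReal.toReal_one, div_one, sub_nonneg]
        rcases eq_or_ne p ∞ with rfl | hp'
        · simp
        · rw [div_le_one (ENNReal.toReal_pos (zero_lt_one.trans_le hp).ne' hp')]
          simpa using ENNReal.toReal_mono hp' hp
      have := ENNReal.Tendsto.mul_const hlim (Or.inr hfin)
      rw [zero_mul] at this
      have := ENNReal.Tendsto.const_mul (a := ENNReal.ofReal K) this (Or.inr ENNReal.ofReal_ne_top)
      rwa [mul_zero] at this
    refine tendsto_of_tendsto_of_tendsto_of_le_of_le' tendsto_const_nhds hlim1
      (Eventually.of_forall fun _ => bot_le) ?_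
    filter_upwards [self_mem_nhdsWithin] with ε hε
    obtain ⟨h1, -⟩ := hreg ε hε
    have hm : AEStronglyMeasurable (fun t => leftFracDerivTrunc θ 0 b ε f t - φ t)
      (volume.restrict (Icc 0 b)) := h1.sub hφm.1
    refine le_trans ?_ (mul_le_mul_right (eLpNorm_le_eLpNorm_mul_rpow_measure_univ hp hm) _)
    refine eLpNorm_le_mul_eLpNorm_of_ae_le_mul (ae_of_all _ fun s => ?_) 1
    simp only [Pi.sub_apply, Pi.mul_apply]
    rw [← sub_mul, norm_mul, mul_comm]
    gcongr
    exact hK s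

/-- As κ > θ, the truncations converge at every interior point, so the limit in the definition must
be the untruncated Marchaud derivative. In particular ψ has a continuous bounded version. -/
theorem HasRightFracDeriv.ae_eq {p : ℝ≥0∞} {ψ : ℝ → ℝ} (hθ : 0 < θ) (hκ : θ < κ) (hb : 0 < b)
    (hp : 1 ≤ p) (hg : ∀ r ∈ Icc 0 b, ∀ s ∈ Icc 0 b, |g r - g s| ≤ C * |r - s| ^ κ)
    (hψ : HasRightFracDeriv θ p 0 b (fun r => g r - Function.leftLim g b) ψ) :
    ψ =ᵐ[volume.restrict (Icc 0 b)] marchaud θ 0 (clipSub b g) := by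
  obtain ⟨hC, hH, hM, hGb, heq⟩ := clipSub_holder hb (hθ.trans hκ) hg
  have hG := continuous_of_holder (hθ.trans hκ) hH
  have hlim : Function.leftLim g b = g b := by
    refine leftLim_eq_of_tendsto ?_
    have h1 : Tendsto (fun r => clipSub b g r + g b) (𝓝[<] b) (𝓝 (g b)) := by
      have := ((hG.tendsto b).mono_left (nhdsWithin_le_nhds (s := Iio b))).add_const (g b)
      rwa [hGb b le_rfl, zero_add] at this
    refine h1.congr' ?_
    filter_upwards [Ioo_mem_nhdsLT hb] with r hr
    rw [heq (Ioo_subset_Icc_self hr), sub_add_cancel]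
  rw [hlim] at hψ
  obtain ⟨-, hψm, hψl⟩ := hψ
  have hae : ∀ ε, 0 < ε → ∀ᵐ r ∂(volume.restrict (Icc 0 b)),
      marchaud θ ε (clipSub b g) r = rightFracDerivTrunc θ 0 b ε (fun r => g r - g b) r := by
    intro ε hε
    rw [← restrict_Ioo_eq_restrict_Icc]
    exact (ae_restrict_mem measurableSet_Ioo).mono fun r hr =>
      (rightFracDerivTrunc_eq hθ hε hG hM hGb heq.symm hr).symm
  refine ae_eq_of_tendsto_eLpNorm (zero_lt_one.trans_le hp).ne' (fun ε hε => ?_) hψm.1 hψl ?_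
  · refine AEStronglyMeasurable.congr ?_ (hae ε hε)
    exact (marchaud_regular hG (integrableOn_const_mul_rpow_Ioi hθ hε (2 * (C * b ^ κ)))
      (fun s w hw => bound_of_bounded hε.le hM s hw)).1.aestronglyMeasurable
  · rw [← restrict_Ioo_eq_restrict_Icc]
    refine (ae_restrict_mem measurableSet_Ioo).mono fun r hr => ?_
    refine (tendsto_marchaud hG (integrableOn_holderBound hθ hκ)
      (fun s w hw => bound_of_holder hH hM s hw) r).congr' ?_
    filter_upwards [self_mem_nhdsWithin] with ε hε
    exact (rightFracDerivTrunc_eq hθ hε hG hM hGb heq.symm hr).symm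

/-- The generalized Young integral is the limit of integrals against densities whose increments are
uniformly Hölder continuous and converge to those of the integrator. -/
theorem HasFracIntegral.exists_approx (h0 : 0 < θ) (h1 : θ < 1) (hb : 0 < b) (hκ : 1 - θ < κ)
    (hf : Measurable ((Icc 0 b).indicator f)) (hM : ∀ r, |(Icc 0 b).indicator f r| ≤ M)
    (hg : ∀ r ∈ Icc 0 b, ∀ s ∈ Icc 0 b, |g r - g s| ≤ C * |r - s| ^ κ)
    (hI : HasFracIntegral θ 0 b f g I) :
    ∃ χ : ℝ → ℝ → ℝ, (∀ ε, 0 < ε → Continuous (χ ε)) ∧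
      (∀ ε, 0 < ε → ∀ u v, 0 ≤ u → u ≤ v → |∫ s in u..v, χ ε s| ≤ C * (v - u) ^ κ) ∧
      (∀ u v, 0 ≤ u → u ≤ v → v ≤ b →
        Tendsto (fun ε => ∫ s in u..v, χ ε s) (𝓝[>] 0) (𝓝 (g v - g u))) ∧
      Tendsto (fun ε => ∫ s in 0..b, f s * χ ε s) (𝓝[>] 0) (𝓝 I) := by
  obtain ⟨p, φ, ψ, hp, hφ, hψ, -, rfl⟩ := hI
  obtain ⟨hC, hH, hGM, hGb, heq⟩ := clipSub_holder hb (by linarith) hg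
  have hG := continuous_of_holder (by linarith) hH
  set G := clipSub b g with hGdef
  obtain ⟨hΨ, K, -, hK⟩ := marchaud_regular (θ := 1 - θ) hG
    (integrableOn_holderBound (by linarith) hκ) (fun s w hw => bound_of_holder hH hGM s hw)
  -- Needed for the integration by parts: no mass may be shifted past b.
  have hΨb : ∀ r, b ≤ r → marchaud (1 - θ) 0 G r = 0 := by
    intro r hr
    have : EqOn (fun w => (G r - G (r + w)) * w ^ (-1 - (1 - θ))) (fun _ => 0) (Ioi 0) := by
      intro w hw
      have hw : 0 < w := hw
      simp [hGb r hr, hGb (r + w) (by linarith)]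
    rw [marchaud, setIntegral_congr_fun measurableSet_Ioi this]
    simp
  -- The sign is the one in front of the integral in the definition. The derivative φ of f is never
  -- computed; its truncations are paired with the regular function ψ and moved onto it.
  refine ⟨fun ε s => -marchaud θ ε (marchaud (1 - θ) 0 G) s, fun ε hε => ?_,
    fun ε hε u v hu huv => ?_, fun u v hu huv hv => ?_, ?_⟩
  · exact (marchaud_regular hΨ (integrableOn_const_mul_rpow_Ioi h0 hε (2 * K))
      (fun s w hw => bound_of_bounded hε.le hK s hw)).1.neg
  · rw [intervalIntegral.integral_neg, abs_neg]
    exact abs_integral_marchaud_marchaud_le h0 h1 hκ hb hε hH hGM hGb hu huv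
  · simp only [intervalIntegral.integral_neg]
    have := (tendsto_integral_marchaud_marchaud h0 h1 hκ hb hH hGM hGb hu huv).neg
    rw [heq ⟨hu, huv.trans hv⟩, heq ⟨hu.trans huv, hv⟩] at this
    simpa using this
  · have hψae := HasRightFracDeriv.ae_eq (by linarith) hκ hb hp hg hψ
    have hval : ∫ r in 0..b, φ r * ψ r = ∫ r in Icc 0 b, φ r * marchaud (1 - θ) 0 G r := by
      rw [intervalIntegral.integral_of_le hb.le, ← integral_Icc_eq_integral_Ioc]
      refine integral_congr_ae ?_
      filter_upwards [hψae] with r hr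
      rw [hr]
    rw [hval]
    refine (HasLeftFracDeriv.tendsto_integral_mul h0 hp hf hM hφ hΨ hK).neg.congr' ?_
    filter_upwards [self_mem_nhdsWithin] with ε hε
    rw [integral_leftFracDerivTrunc_mul h0 hε hf hM hΨ hK hΨb,
      intervalIntegral.integral_of_le hb.le, ← integral_Icc_eq_integral_Ioc, ← integral_neg]
    simp only [mul_neg]

end

/-! ### Dyadic Riemann sums. -/

/-- The points of the dyadic partition of `[0, T]` of level `n`. -/
noncomputable def grid (T : ℝ) (n k : ℕ) : ℝ := k * (T / 2 ^ n)

open Classical in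
/-- The intervals of the dyadic partition of level `n` on which `f` is not constant. -/
noncomputable def nonflat (T : ℝ) (f : ℝ → ℝ) (n : ℕ) : Finset ℕ :=
  (Finset.range (2 ^ n)).filter fun k =>
    ¬ ∀ s ∈ Icc (grid T n k) (grid T n (k + 1)), f s = f (grid T n k)

section
variable {θ T κ C M I : ℝ} {f g : ℝ → ℝ}

theorem grid_zero (T : ℝ) (n : ℕ) : grid T n 0 = 0 := by simp [grid]

theorem grid_two_mul (T : ℝ) (n k : ℕ) : grid T (n + 1) (2 * k) = grid T n k := by
  simp only [grid, pow_succ]; push_cast; field_simp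

theorem grid_add (T : ℝ) (n j k : ℕ) : grid T (n + j) (k * 2 ^ j) = grid T n k := by
  simp only [grid, pow_add]; push_cast; field_simp

theorem grid_pow (T : ℝ) (n : ℕ) : grid T n (2 ^ n) = T := by
  simp only [grid]; push_cast; field_simp

theorem grid_succ_sub (T : ℝ) (n k : ℕ) : grid T n (k + 1) - grid T n k = T / 2 ^ n := by
  simp only [grid]; push_cast; ring

theorem grid_mono (hT : 0 < T) (n : ℕ) {k l : ℕ} (h : k ≤ l) : grid T n k ≤ grid T n l := by
  have : (k : ℝ) ≤ l := by exact_mod_cast h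
  simp only [grid]
  gcongr

theorem grid_nonneg (hT : 0 < T) (n k : ℕ) : 0 ≤ grid T n k := by
  rw [← grid_zero T n]; exact grid_mono hT n (Nat.zero_le k)

theorem grid_mem (hT : 0 < T) {n k : ℕ} (h : k ≤ 2 ^ n) : grid T n k ∈ Icc 0 T :=
  ⟨grid_nonneg hT n k, (grid_mono hT n h).trans (grid_pow T n).le⟩

theorem sum_range_two_mul (a : ℕ → ℝ) (n : ℕ) :
    ∑ k ∈ Finset.range (2 * n), a k = ∑ k ∈ Finset.range n, (a (2 * k) + a (2 * k + 1)) := by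
  induction n with
  | zero => simp
  | succ n ih =>
    rw [Finset.sum_range_succ, ← ih, show 2 * (n + 1) = 2 * n + 1 + 1 by ring,
      Finset.sum_range_succ, Finset.sum_range_succ]
    ring

theorem abs_sum_range_le_card_mul {m : ℕ} {S : Finset ℕ} {a : ℕ → ℝ} {B : ℝ}
    (ha : ∀ k < m, k ∈ S → |a k| ≤ B) (ha0 : ∀ k < m, k ∉ S → a k = 0) (hB : 0 ≤ B) :
    |∑ k ∈ Finset.range m, a k| ≤ S.card * B := by
  have hsub : Finset.range m ∩ S ⊆ S := Finset.inter_subset_right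
  calc |∑ k ∈ Finset.range m, a k| ≤ ∑ k ∈ Finset.range m, |a k| := Finset.abs_sum_le_sum_abs _ _
    _ = ∑ k ∈ Finset.range m ∩ S, |a k| := by
        refine (Finset.sum_subset Finset.inter_subset_left fun k hk hk' => ?_).symm
        rw [ha0 k (Finset.mem_range.1 hk) (fun h => hk' (Finset.mem_inter.2 ⟨hk, h⟩)), abs_zero]
    _ ≤ ∑ k ∈ Finset.range m ∩ S, B := by
        refine Finset.sum_le_sum fun k hk => ?_
        exact ha k (Finset.mem_range.1 (Finset.mem_inter.1 hk).1) (Finset.mem_inter.1 hk).2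
    _ ≤ S.card * B := by
        rw [Finset.sum_const, nsmul_eq_mul]
        gcongr

theorem eq_of_notMem_nonflat {n k : ℕ} (hk : k < 2 ^ n) (h : k ∉ nonflat T f n) {s : ℝ}
    (hs : s ∈ Icc (grid T n k) (grid T n (k + 1))) : f s = f (grid T n k) := by
  by_contra hne
  refine h ?_
  simp only [nonflat, Finset.mem_filter, Finset.mem_range]
  exact ⟨hk, fun hall => hne (hall s hs)⟩

/-- Inserting a midpoint changes a term by the increment of f from the left end to the midpoint,
times the integral of χ over the right half. It vanishes if f is constant on the interval. The bound
uses χ only through C, hence is uniform over the densities χ_ε. -/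
theorem abs_riemannSum_succ_sub_le (hT : 0 < T) (hM : ∀ s ∈ Icc 0 T, |f s| ≤ M) (hC : 0 ≤ C)
    (hκ : 0 ≤ κ) {n m : ℕ} (hm : m ≤ 2 ^ n) {χ : ℝ → ℝ} (hχ : Continuous χ)
    (hχC : ∀ u v, 0 ≤ u → u ≤ v → |∫ s in u..v, χ s| ≤ C * (v - u) ^ κ) :
    |(∑ k ∈ Finset.range (2 * m),
        f (grid T (n + 1) k) * ∫ s in grid T (n + 1) k..grid T (n + 1) (k + 1), χ s) -
      ∑ k ∈ Finset.range m, f (grid T n k) * ∫ s in grid T n k..grid T n (k + 1), χ s| ≤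
      (nonflat T f n).card * (2 * M * C * (T / 2 ^ n) ^ κ) := by
  have hM0 : 0 ≤ M := (abs_nonneg _).trans (hM 0 ⟨le_rfl, hT.le⟩)
  rw [sum_range_two_mul, ← Finset.sum_sub_distrib]
  have hterm : ∀ k, f (grid T (n + 1) (2 * k)) *
        (∫ s in grid T (n + 1) (2 * k)..grid T (n + 1) (2 * k + 1), χ s) +
      f (grid T (n + 1) (2 * k + 1)) *
        (∫ s in grid T (n + 1) (2 * k + 1)..grid T (n + 1) (2 * k + 1 + 1), χ s) -
      f (grid T n k) * (∫ s in grid T n k..grid T n (k + 1), χ s) =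
      (f (grid T (n + 1) (2 * k + 1)) - f (grid T n k)) *
        ∫ s in grid T (n + 1) (2 * k + 1)..grid T n (k + 1), χ s := by
    intro k
    have e : grid T (n + 1) (2 * k + 1 + 1) = grid T n (k + 1) :=
      grid_two_mul T n (k + 1)
    rw [grid_two_mul, e, ← intervalIntegral.integral_add_adjacent_intervals
      (hχ.intervalIntegrable (grid T n k) (grid T (n + 1) (2 * k + 1)))
      (hχ.intervalIntegrable (grid T (n + 1) (2 * k + 1)) (grid T n (k + 1)))]
    ring
  have hle1 : ∀ k, grid T n k ≤ grid T (n + 1) (2 * k + 1) := fun k => by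
    rw [← grid_two_mul]; exact grid_mono hT _ (by omega)
  have hle2 : ∀ k, grid T (n + 1) (2 * k + 1) ≤ grid T n (k + 1) := fun k => by
    rw [← grid_two_mul T n (k + 1)]; exact grid_mono hT _ (by omega)
  refine abs_sum_range_le_card_mul (fun k hk hbad => ?_) (fun k hk hgood => ?_) (by positivity)
  · rw [hterm, abs_mul]
    have hk1 : grid T n (k + 1) ∈ Icc 0 T := grid_mem hT (by omega)
    have hk0 : grid T n k ∈ Icc 0 T := grid_mem hT (by omega)
    have h1 : |f (grid T (n + 1) (2 * k + 1)) - f (grid T n k)| ≤ 2 * M := by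
      have := hM _ ⟨hk0.1.trans (hle1 k), (hle2 k).trans hk1.2⟩
      have := hM _ hk0
      exact (abs_sub _ _).trans (by linarith)
    have h2 : |∫ s in grid T (n + 1) (2 * k + 1)..grid T n (k + 1), χ s| ≤
        C * (T / 2 ^ n) ^ κ := by
      refine (hχC _ _ (hk0.1.trans (hle1 k)) (hle2 k)).trans ?_
      gcongr
      · exact sub_nonneg.2 (hle2 k)
      · rw [← grid_succ_sub T n k]; linarith [hle1 k]
    calc _ ≤ 2 * M * (C * (T / 2 ^ n) ^ κ) := by gcongr
      _ = _ := by ring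
  · rw [hterm, eq_of_notMem_nonflat (lt_of_lt_of_le hk hm) hgood ⟨hle1 k, hle2 k⟩, sub_self, zero_mul]

/-- This bound uses the supremum K of the density, so it need not be uniform in ε. It serves only to
identify the limit of the Riemann sums for a fixed density. -/
theorem abs_integral_sub_riemannSum_le (hT : 0 < T) (hf : Measurable ((Icc 0 T).indicator f))
    (hM : ∀ s ∈ Icc 0 T, |f s| ≤ M) {n m : ℕ} (hm : m ≤ 2 ^ n) {χ : ℝ → ℝ} (hχ : Continuous χ)
    {K : ℝ} (hK : ∀ s ∈ Icc 0 T, |χ s| ≤ K) :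
    |(∫ s in 0..grid T n m, f s * χ s) -
      ∑ k ∈ Finset.range m, f (grid T n k) * ∫ s in grid T n k..grid T n (k + 1), χ s| ≤
      (nonflat T f n).card * (2 * M * K * (T / 2 ^ n)) := by
  have hM0 : 0 ≤ M := (abs_nonneg _).trans (hM 0 ⟨le_rfl, hT.le⟩)
  have hK0 : 0 ≤ K := (abs_nonneg _).trans (hK 0 ⟨le_rfl, hT.le⟩)
  have hfi : IntegrableOn f (Icc 0 T) := by
    refine (integrableOn_congr_fun (eqOn_indicator (f := f)) measurableSet_Icc).1 ?_
    refine Integrable.of_bound hf.aestronglyMeasurable M (ae_of_all _ fun s => ?_)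
    by_cases hs : s ∈ Icc 0 T
    · rw [indicator_of_mem hs]; exact hM s hs
    · rw [indicator_of_notMem hs, norm_zero]; exact hM0
  have hfχ : IntegrableOn (fun s => f s * χ s) (Icc 0 T) :=
    IntegrableOn.mul_continuousOn hfi hχ.continuousOn isCompact_Icc
  have hii : ∀ u ∈ Icc 0 T, ∀ v ∈ Icc 0 T, IntervalIntegrable (fun s => f s * χ s) volume u v :=
    fun u hu v hv => (hfχ.mono_set (ordConnected_Icc.uIcc_subset hu hv)).intervalIntegrable
  have hsum : ∫ s in 0..grid T n m, f s * χ s =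
      ∑ k ∈ Finset.range m, ∫ s in grid T n k..grid T n (k + 1), f s * χ s := by
    rw [intervalIntegral.sum_integral_adjacent_intervals, grid_zero]
    exact fun k hk => hii _ (grid_mem hT (by omega)) _ (grid_mem hT (by omega))
  rw [hsum, ← Finset.sum_sub_distrib]
  have hterm : ∀ k < m, (∫ s in grid T n k..grid T n (k + 1), f s * χ s) -
      f (grid T n k) * (∫ s in grid T n k..grid T n (k + 1), χ s) =
      ∫ s in grid T n k..grid T n (k + 1), (f s - f (grid T n k)) * χ s := by
    intro k hk
    rw [← intervalIntegral.integral_const_mul, ← intervalIntegral.integral_sub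
      (hii _ (grid_mem hT (by omega)) _ (grid_mem hT (by omega)))
      ((hχ.intervalIntegrable _ _).const_mul _)]
    simp only [sub_mul]
  have hle : ∀ k, grid T n k ≤ grid T n (k + 1) := fun k => grid_mono hT n (Nat.le_succ k)
  refine abs_sum_range_le_card_mul (fun k hk hbad => ?_) (fun k hk hgood => ?_) (by positivity)
  · rw [hterm k hk, ← grid_succ_sub T n k, ← abs_of_nonneg (sub_nonneg.2 (hle k)),
      ← Real.norm_eq_abs]
    refine intervalIntegral.norm_integral_le_of_norm_le_const fun s hs => ?_
    rw [uIoc_of_le (hle k)] at hs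
    have hk0 : grid T n k ∈ Icc 0 T := grid_mem hT (by omega)
    have hk1 : grid T n (k + 1) ∈ Icc 0 T := grid_mem hT (by omega)
    have hs' : s ∈ Icc 0 T := ⟨hk0.1.trans hs.1.le, hs.2.trans hk1.2⟩
    rw [norm_mul]
    have h1 : ‖f s - f (grid T n k)‖ ≤ 2 * M :=
      (abs_sub _ _).trans (by linarith [hM s hs', hM _ hk0])
    exact mul_le_mul h1 (hK s hs') (norm_nonneg _) (by positivity)
  · rw [hterm k hk, intervalIntegral.integral_congr (g := fun _ => 0)]
    · simp
    · intro s hs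
      rw [uIcc_of_le (hle k)] at hs
      simp [eq_of_notMem_nonflat (lt_of_lt_of_le hk hm) hgood hs]

/-- The generalized Young integral of a function that is constant on most dyadic intervals is the
limit of its dyadic Riemann sums. -/
theorem HasFracIntegral.tendsto_riemannSum (h0 : 0 < θ) (h1 : θ < 1) (hT : 0 < T)
    (hκ : 1 - θ < κ) (hκ1 : κ < 1)
    (hf : Measurable ((Icc 0 T).indicator f)) (hM : ∀ s ∈ Icc 0 T, |f s| ≤ M)
    (hg : ∀ r ∈ Icc 0 T, ∀ s ∈ Icc 0 T, |g r - g s| ≤ C * |r - s| ^ κ)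
    (hN : Summable fun n => ((nonflat T f n).card : ℝ) * (T / 2 ^ n) ^ κ)
    {n m : ℕ} (hm0 : 0 < m) (hm : m ≤ 2 ^ n) (hI : HasFracIntegral θ 0 (grid T n m) f g I) :
    Tendsto (fun j => ∑ k ∈ Finset.range (m * 2 ^ j),
      f (grid T (n + j) k) * (g (grid T (n + j) (k + 1)) - g (grid T (n + j) k))) atTop (𝓝 I) := by
  have hM0 : 0 ≤ M := (abs_nonneg _).trans (hM 0 ⟨le_rfl, hT.le⟩)
  have hκ0 : 0 < κ := by linarith
  have hC : 0 ≤ C := (clipSub_holder hT hκ0 hg).1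
  have hb : 0 < grid T n m := by simp only [grid]; positivity
  have hbT : grid T n m ≤ T := (grid_mem hT hm).2
  have hmj : ∀ j, m * 2 ^ j ≤ 2 ^ (n + j) := fun j => by
    rw [pow_add]; exact Nat.mul_le_mul_right _ hm
  have hsub : Icc 0 (grid T n m) ⊆ Icc 0 T := Icc_subset_Icc_right hbT
  have hfb : Measurable ((Icc 0 (grid T n m)).indicator f) := by
    have : (Icc 0 (grid T n m)).indicator f =
        (Icc 0 (grid T n m)).indicator ((Icc 0 T).indicator f) := by
      rw [indicator_indicator, inter_eq_left.2 hsub]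
    rw [this]
    exact hf.indicator measurableSet_Icc
  have hMb : ∀ r, |(Icc 0 (grid T n m)).indicator f r| ≤ M := by
    intro r
    by_cases hr : r ∈ Icc 0 (grid T n m)
    · rw [indicator_of_mem hr]; exact hM r (hsub hr)
    · rw [indicator_of_notMem hr, abs_zero]; exact hM0
  obtain ⟨χ, hχc, hχC, hχg, hχI⟩ := hI.exists_approx h0 h1 hb hκ hfb hMb
    (fun r hr s hs => hg r (hsub hr) s (hsub hs))
  set e : ℕ → ℝ := fun j => (nonflat T f (n + j)).card * (2 * M * C * (T / 2 ^ (n + j)) ^ κ)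
    with he
  have hNj : Summable fun j => ((nonflat T f (n + j)).card : ℝ) * (T / 2 ^ (n + j)) ^ κ := by
    have := (summable_nat_add_iff n).2 hN
    simpa only [add_comm n] using this
  have hes : Summable e := by
    refine (hNj.mul_left (2 * M * C)).congr fun j => ?_
    simp only [he]; ring
  -- For fixed ε the refinements telescope from level n + j to the integral. The resulting tail is
  -- free of ε, which is what permits ε → 0 afterwards.
  have hbound : ∀ ε, 0 < ε → ∀ j, |(∫ s in 0..grid T n m, f s * χ ε s) -
      ∑ k ∈ Finset.range (m * 2 ^ j), f (grid T (n + j) k) *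
        ∫ s in grid T (n + j) k..grid T (n + j) (k + 1), χ ε s| ≤ ∑' i, e (j + i) := by
    intro ε hε j
    set R : ℕ → ℝ := fun j => ∑ k ∈ Finset.range (m * 2 ^ j), f (grid T (n + j) k) *
      ∫ s in grid T (n + j) k..grid T (n + j) (k + 1), χ ε s with hR
    have hdist : ∀ j, dist (R j) (R j.succ) ≤ e j := by
      intro j
      rw [dist_comm, Real.dist_eq]
      have := abs_riemannSum_succ_sub_le hT hM hC hκ0.le (hmj j) (hχc ε hε) (hχC ε hε)
      simp only [hR, Nat.succ_eq_add_one, pow_succ, ← add_assoc]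
      rwa [show 2 * (m * 2 ^ j) = m * (2 ^ j * 2) by ring] at this
    obtain ⟨K, hK⟩ := (isCompact_Icc (a := (0 : ℝ)) (b := T)).exists_bound_of_continuousOn
      (hχc ε hε).continuousOn
    have hK0 : 0 ≤ K := (norm_nonneg _).trans (hK 0 ⟨le_rfl, hT.le⟩)
    have hlim : Tendsto R atTop (𝓝 (∫ s in 0..grid T n m, f s * χ ε s)) := by
      -- Since κ < 1, a mesh δ ≤ T satisfies δ ≤ T^(1-κ) δ^κ, so the assumed summability controls
      -- this error too.
      have h0' : Tendsto (fun j => 2 * M * K * T ^ (1 - κ) *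
          (((nonflat T f (n + j)).card : ℝ) * (T / 2 ^ (n + j)) ^ κ)) atTop (𝓝 0) := by
        have := hNj.tendsto_atTop_zero.const_mul (2 * M * K * T ^ (1 - κ))
        rwa [mul_zero] at this
      rw [tendsto_iff_dist_tendsto_zero]
      refine squeeze_zero (fun _ => dist_nonneg) (fun j => ?_) h0'
      rw [dist_comm, Real.dist_eq]
      have := abs_integral_sub_riemannSum_le hT hf hM (hmj j) (hχc ε hε) hK
      rw [grid_add] at this
      refine this.trans ?_
      have hδ : 0 < T / 2 ^ (n + j) := by positivity
      have hδT : T / 2 ^ (n + j) ≤ T := div_le_self hT.le (one_le_pow₀ one_le_two)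
      have : T / 2 ^ (n + j) ≤ T ^ (1 - κ) * (T / 2 ^ (n + j)) ^ κ := by
        calc T / 2 ^ (n + j) = (T / 2 ^ (n + j)) ^ (1 - κ) * (T / 2 ^ (n + j)) ^ κ := by
              rw [← Real.rpow_add hδ]; simp
          _ ≤ _ := by gcongr
      calc _ ≤ ((nonflat T f (n + j)).card : ℝ) *
            (2 * M * K * (T ^ (1 - κ) * (T / 2 ^ (n + j)) ^ κ)) := by gcongr
        _ = _ := by ring
    have := dist_le_tsum_of_dist_le_of_tendsto e hdist hes hlim j
    rwa [dist_comm, Real.dist_eq] at this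
  -- At a fixed level the sum is finite, and each integral of χ_ε tends to an increment of g.
  have hlimε : ∀ j, |I - ∑ k ∈ Finset.range (m * 2 ^ j), f (grid T (n + j) k) *
      (g (grid T (n + j) (k + 1)) - g (grid T (n + j) k))| ≤ ∑' i, e (j + i) := by
    intro j
    have hR : Tendsto (fun ε => ∑ k ∈ Finset.range (m * 2 ^ j), f (grid T (n + j) k) *
        ∫ s in grid T (n + j) k..grid T (n + j) (k + 1), χ ε s) (𝓝[>] 0)
        (𝓝 (∑ k ∈ Finset.range (m * 2 ^ j), f (grid T (n + j) k) *
          (g (grid T (n + j) (k + 1)) - g (grid T (n + j) k)))) := by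
      refine tendsto_finsetSum _ fun k hk => (hχg _ _ (grid_nonneg hT _ _)
        (grid_mono hT _ (Nat.le_succ k)) ?_).const_mul _
      rw [← grid_add T n j m]
      exact grid_mono hT _ (Finset.mem_range.1 hk)
    refine le_of_tendsto (hχI.sub hR).abs ?_
    filter_upwards [self_mem_nhdsWithin] with ε hε
    exact hbound ε hε j
  rw [tendsto_iff_dist_tendsto_zero]
  have htail : Tendsto (fun j => ∑' i, e (j + i)) atTop (𝓝 0) := by
    simpa only [add_comm] using tendsto_sum_nat_add e
  refine squeeze_zero (fun _ => dist_nonneg) (fun j => ?_) htail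
  rw [dist_comm, Real.dist_eq]
  exact hlimε j

end

/-! ### Dyadic chaining and the Hölder continuity of fractional Brownian motion. -/

theorem grid_floor_le {T u : ℝ} (hT : 0 < T) (n : ℕ) (hu : 0 ≤ u) :
    grid T n ⌊u * 2 ^ n / T⌋₊ ≤ u := by
  have := Nat.floor_le (div_nonneg (mul_nonneg hu (by positivity)) hT.le : 0 ≤ u * 2 ^ n / T)
  rw [le_div_iff₀ hT] at this
  simp only [grid]
  rw [mul_div_assoc', div_le_iff₀ (by positivity)]
  exact this

theorem le_grid_floor_add {T : ℝ} (hT : 0 < T) (n : ℕ) (u : ℝ) :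
    u ≤ grid T n ⌊u * 2 ^ n / T⌋₊ + T / 2 ^ n := by
  have := (Nat.lt_floor_add_one (u * 2 ^ n / T)).le
  rw [div_le_iff₀ hT] at this
  simp only [grid]
  rw [mul_div_assoc', ← add_div, le_div_iff₀ (by positivity)]
  linarith

theorem floor_le_two_pow {T u : ℝ} (hT : 0 < T) (n : ℕ) (hu : u ∈ Icc 0 T) :
    ⌊u * 2 ^ n / T⌋₊ ≤ 2 ^ n := by
  refine Nat.floor_le_of_le ?_
  push_cast
  rw [div_le_iff₀ hT, mul_comm]
  gcongr
  exact hu.2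

theorem tendsto_grid_floor {T u : ℝ} (hT : 0 < T) (hu : u ∈ Icc 0 T) :
    Tendsto (fun n => grid T n ⌊u * 2 ^ n / T⌋₊) atTop (𝓝[Icc 0 T] u) := by
  have h0 : Tendsto (fun n : ℕ => u - T / 2 ^ n) atTop (𝓝 u) := by
    have := (tendsto_pow_atTop_nhds_zero_of_lt_one (r := (1 / 2 : ℝ)) (by norm_num)
      (by norm_num)).const_mul T
    have := this.const_sub u
    rw [mul_zero, sub_zero] at this
    refine this.congr fun n => ?_
    rw [one_div_pow, mul_one_div]
  refine tendsto_nhdsWithin_iff.2 ⟨tendsto_of_tendsto_of_tendsto_of_le_of_le h0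
    tendsto_const_nhds (fun n => ?_) (fun n => grid_floor_le hT n hu.1),
    Eventually.of_forall fun n => grid_mem hT (floor_le_two_pow hT n hu)⟩
  exact sub_le_iff_le_add.2 (le_grid_floor_add hT n u)

/-- A continuous function with Hölder bounds on its dyadic increments is Hölder continuous. -/
theorem holder_of_grid {T κ A : ℝ} {g : ℝ → ℝ} (hT : 0 < T) (hκ : 0 < κ)
    (hg : ContinuousOn g (Icc 0 T))
    (hA : ∀ n, ∀ k < 2 ^ n, |g (grid T n (k + 1)) - g (grid T n k)| ≤ A * (T / 2 ^ n) ^ κ) :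
    ∃ C, ∀ r ∈ Icc 0 T, ∀ s ∈ Icc 0 T, |g r - g s| ≤ C * |r - s| ^ κ := by
  have hA0 : 0 ≤ A := by
    have := (abs_nonneg _).trans (hA 0 0 (by simp))
    exact nonneg_of_mul_nonneg_left this (by positivity)
  set ρ : ℝ := (1 / 2) ^ κ with hρ
  have hρ0 : 0 < ρ := by positivity
  have hρ1 : ρ < 1 := Real.rpow_lt_one (by norm_num) (by norm_num) hκ
  have hpow : ∀ n : ℕ, (T / 2 ^ n) ^ κ = T ^ κ * ρ ^ n := by
    intro n
    rw [div_eq_mul_one_div, ← one_div_pow, Real.mul_rpow hT.le (by positivity), hρ,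
      ← Real.rpow_natCast, ← Real.rpow_natCast, ← Real.rpow_mul (by norm_num),
      ← Real.rpow_mul (by norm_num), mul_comm κ]
  set F : ℕ → ℝ → ℕ := fun n u => ⌊u * 2 ^ n / T⌋₊ with hF
  have hFle : ∀ n, ∀ u ∈ Icc 0 T, (F n u : ℝ) ≤ u * 2 ^ n / T := fun n u hu =>
    Nat.floor_le (div_nonneg (mul_nonneg hu.1 (by positivity)) hT.le)
  have hFlt : ∀ n u, u * 2 ^ n / T < F n u + 1 := fun n u => Nat.lt_floor_add_one _
  have hFpow : ∀ n, ∀ u ∈ Icc 0 T, F n u ≤ 2 ^ n := fun n u hu => floor_le_two_pow hT n hu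
  have hstep : ∀ n k l, l ≤ 2 ^ n → (l = k ∨ l = k + 1) →
      |g (grid T n k) - g (grid T n l)| ≤ A * (T / 2 ^ n) ^ κ := by
    rintro n k l hl (rfl | rfl)
    · rw [sub_self, abs_zero]; positivity
    · rw [abs_sub_comm]; exact hA n k (by omega)
  have happrox : ∀ u ∈ Icc 0 T, ∀ n, |g (grid T n (F n u)) - g u| ≤
      A * T ^ κ * ρ ^ n / (1 - ρ) := by
    intro u hu n
    refine dist_le_of_le_geometric_of_tendsto ρ (A * T ^ κ) hρ1 (fun n => ?_) ?_ n
      (f := fun n => g (grid T n (F n u)))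
    · rw [Real.dist_eq, ← grid_two_mul T n]
      -- Passing to the next level moves the dyadic approximation from below by at most one step of
      -- that level.
      have h2 : F (n + 1) u = 2 * F n u ∨ F (n + 1) u = 2 * F n u + 1 := by
        have e : u * 2 ^ (n + 1) / T = 2 * (u * 2 ^ n / T) := by rw [pow_succ]; ring
        have a1 := hFle n u hu
        have a2 := hFlt n u
        have b1 := hFle (n + 1) u hu
        have b2 := hFlt (n + 1) u
        rw [e] at b1 b2
        have c1 : 2 * F n u < F (n + 1) u + 1 := by
          have : (2 * F n u : ℝ) < F (n + 1) u + 1 := by linarith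
          exact_mod_cast this
        have c2 : F (n + 1) u < 2 * F n u + 2 := by
          have : (F (n + 1) u : ℝ) < 2 * F n u + 2 := by linarith
          exact_mod_cast this
        omega
      refine (hstep (n + 1) _ _ (hFpow _ u hu) h2).trans ?_
      rw [hpow, pow_succ, ← mul_assoc]
      have : 0 ≤ A * T ^ κ * ρ ^ n := by positivity
      nlinarith
    · exact (hg u hu).tendsto.comp (tendsto_grid_floor hT hu)
  -- Two chaining tails, from r and from s, plus one dyadic step joining the approximations.
  set K := 2 * (A * T ^ κ / (1 - ρ)) + A * T ^ κ with hK
  have hK0 : 0 ≤ K := by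
    have : 0 < 1 - ρ := by linarith
    positivity
  have hmain : ∀ r ∈ Icc 0 T, ∀ s ∈ Icc 0 T, r < s → |g r - g s| ≤ K / (T ^ κ * ρ) * |r - s| ^ κ := by
    intro r hr s hs hrs
    -- The level with T/2^(n+1) < s - r ≤ T/2^n, at which the two approximations are equal or
    -- adjacent.
    obtain ⟨n, hn1, hn2⟩ := exists_nat_pow_near_of_lt_one (x := (s - r) / T) (y := (1 / 2 : ℝ))
      (div_pos (sub_pos.2 hrs) hT) ((div_le_one hT).2 (by linarith [hr.1, hs.2])) (by norm_num)
      (by norm_num)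
    have hF2 : F n s = F n r ∨ F n s = F n r + 1 := by
      have hle : s * 2 ^ n / T ≤ r * 2 ^ n / T + 1 := by
        rw [one_div_pow, div_le_div_iff₀ hT (by positivity)] at hn2
        rw [div_add_one hT.ne', div_le_div_iff_of_pos_right hT]
        linarith
      have hle' : r * 2 ^ n / T ≤ s * 2 ^ n / T := by gcongr
      have c1 : F n s < F n r + 2 := by
        have : (F n s : ℝ) < F n r + 2 := by linarith [hFle n s hs, hFlt n r]
        exact_mod_cast this
      have c2 : F n r < F n s + 1 := by
        have : (F n r : ℝ) < F n s + 1 := by linarith [hFle n r hr, hFlt n s]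
        exact_mod_cast this
      omega
    have h1 := happrox r hr n
    have h2 := happrox s hs n
    have h3 := hstep n _ _ (hFpow n s hs) hF2
    rw [hpow] at h3
    have htri : |g r - g s| ≤ K * ρ ^ n := by
      have e : g r - g s = -(g (grid T n (F n r)) - g r) +
        (g (grid T n (F n r)) - g (grid T n (F n s))) + (g (grid T n (F n s)) - g s) := by ring
      rw [e]
      refine (abs_add_three _ _ _).trans ?_
      rw [abs_neg]
      calc _ ≤ A * T ^ κ * ρ ^ n / (1 - ρ) + A * (T ^ κ * ρ ^ n) +
            A * T ^ κ * ρ ^ n / (1 - ρ) := by gcongr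
        _ = K * ρ ^ n := by rw [hK]; ring
    have hpn : T ^ κ * ρ * ρ ^ n ≤ |r - s| ^ κ := by
      rw [mul_assoc, ← pow_succ', ← hpow, abs_sub_comm, abs_of_pos (sub_pos.2 hrs)]
      have : T / 2 ^ (n + 1) ≤ s - r := by
        rw [one_div_pow, lt_div_iff₀ hT, one_div_mul_eq_div] at hn1
        exact hn1.le
      gcongr
    calc |g r - g s| ≤ K * ρ ^ n := htri
      _ = K / (T ^ κ * ρ) * (T ^ κ * ρ * ρ ^ n) := by
          have : T ^ κ ≠ 0 := by positivity
          field_simp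
      _ ≤ _ := by gcongr
  refine ⟨K / (T ^ κ * ρ), fun r hr s hs => ?_⟩
  rcases lt_trichotomy r s with h | h | h
  · exact hmain r hr s hs h
  · rw [h, sub_self, abs_zero]; positivity
  · rw [abs_sub_comm, abs_sub_comm r]; exact hmain s hs r hr h

section
variable {Ω : Type*} [MeasurableSpace Ω] {P : Measure Ω}

/-- A Borel–Cantelli argument in expectation: the expected total is at most a convergent geometric
series. It is applied to the increments of the driver and to the dyadic intervals with zeros. -/
theorem ae_tsum_lt_top {a : ℕ → ℕ → Ω → ℝ≥0∞} (ha : ∀ n k, AEMeasurable (a n k) P) {C q : ℝ}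
    (hC : 0 ≤ C) (hq0 : 0 ≤ q) (hq1 : q < 1)
    (hb : ∀ n, ∑ k ∈ Finset.range (2 ^ n), ∫⁻ ω, a n k ω ∂P ≤ ENNReal.ofReal (C * q ^ n)) :
    ∀ᵐ ω ∂P, ∑' n, ∑ k ∈ Finset.range (2 ^ n), a n k ω < ∞ := by
  have hm : ∀ n, AEMeasurable (fun ω => ∑ k ∈ Finset.range (2 ^ n), a n k ω) P := fun n =>
    Finset.aemeasurable_fun_sum _ fun k _ => ha n k
  refine ae_lt_top' (AEMeasurable.tsum hm) ?_
  rw [lintegral_tsum hm]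
  have hs : Summable fun n => C * q ^ n := (summable_geometric_of_lt_one hq0 hq1).mul_left C
  refine ne_top_of_le_ne_top (ENNReal.ofReal_ne_top (r := ∑' n, C * q ^ n)) ?_
  rw [ENNReal.ofReal_tsum_of_nonneg (fun n => by positivity) hs]
  refine ENNReal.tsum_le_tsum fun n => ?_
  rw [lintegral_finsetSum' _ fun k _ => ha n k]
  exact hb n

theorem lintegral_abs_pow_of_hasGaussianLaw [IsProbabilityMeasure P] {X : Ω → ℝ}
    (hX : HasGaussianLaw X P)
    (hmean : ∫ ω, X ω ∂P = 0) {c : ℝ} (hc : 0 ≤ c) (hvar : ∫ ω, X ω ^ 2 ∂P = c ^ 2) (p : ℕ) :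
    ∫⁻ ω, ENNReal.ofReal (|X ω| ^ p) ∂P =
      ENNReal.ofReal (c ^ p) * ∫⁻ x, ENNReal.ofReal (|x| ^ p) ∂(gaussianReal 0 1) := by
  have hm : Measurable fun x : ℝ => ENNReal.ofReal (|x| ^ p) := by fun_prop
  have hlaw : P.map X = (gaussianReal 0 1).map (fun x => c * x) := by
    rw [hX.map_eq_gaussianReal, hmean, variance_of_integral_eq_zero hX.aemeasurable hmean, hvar,
      gaussianReal_map_const_mul, mul_zero, mul_one]
    congr 1
    ext
    simp [sq_nonneg]
  rw [← lintegral_map' hm.aemeasurable hX.aemeasurable, hlaw,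
    lintegral_map hm (measurable_const_mul c), ← lintegral_const_mul _ hm]
  refine lintegral_congr fun x => ?_
  rw [abs_mul, mul_pow, abs_of_nonneg hc, ENNReal.ofReal_mul (by positivity)]

theorem lintegral_abs_pow_gaussianReal_lt_top (p : ℕ) :
    ∫⁻ x, ENNReal.ofReal (|x| ^ p) ∂(gaussianReal 0 1) < ∞ := by
  have h := (memLp_id_gaussianReal (μ := 0) (v := 1) p).integrable_norm_pow'
  have := h.lintegral_lt_top
  simpa using this

variable {H T : ℝ} {B : ℝ → Ω → ℝ}

theorem IsFractionalBrownianMotion.hasGaussianLaw_sub (hB : IsFractionalBrownianMotion H B P)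
    {s t : ℝ} (hs : 0 ≤ s) (ht : 0 ≤ t) : HasGaussianLaw (fun ω => B t ω - B s ω) P :=
  hB.gaussian.hasGaussianLaw_fun_sub (s := ⟨t, ht⟩) (t := ⟨s, hs⟩)

theorem IsFractionalBrownianMotion.hasGaussianLaw (hB : IsFractionalBrownianMotion H B P)
    {t : ℝ} (ht : 0 ≤ t) : HasGaussianLaw (B t) P :=
  hB.gaussian.hasGaussianLaw_eval (⟨t, ht⟩ : ℝ≥0)

theorem IsFractionalBrownianMotion.integral_sub_sq [IsProbabilityMeasure P]
    (hB : IsFractionalBrownianMotion H B P)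
    (hH : 0 < H) {s t : ℝ} (hs : 0 ≤ s) (ht : 0 ≤ t) :
    ∫ ω, (B t ω - B s ω) ∂P = 0 ∧ ∫ ω, (B t ω - B s ω) ^ 2 ∂P = (|t - s| ^ H) ^ 2 := by
  have it := hB.hasGaussianLaw ht
  have is := hB.hasGaussianLaw hs
  constructor
  · rw [integral_sub it.integrable is.integrable, hB.centered t ht, hB.centered s hs, sub_zero]
  · have m : ∀ {u v : ℝ}, 0 ≤ u → 0 ≤ v → Integrable (fun ω => B u ω * B v ω) P := fun hu hv =>
      (hB.hasGaussianLaw hu).memLp_two.integrable_mul (hB.hasGaussianLaw hv).memLp_two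
    have e : ∀ ω, (B t ω - B s ω) ^ 2 = B t ω * B t ω - 2 * (B t ω * B s ω) + B s ω * B s ω :=
      fun ω => by ring
    have i1 : Integrable (fun ω => B t ω * B t ω - 2 * (B t ω * B s ω)) P :=
      (m ht ht).sub ((m ht hs).const_mul 2)
    simp only [e]
    rw [integral_add i1 (m hs hs),
      integral_sub (m ht ht) ((m ht hs).const_mul 2), integral_const_mul, hB.covariance t t ht ht,
      hB.covariance s t hs ht, hB.covariance s s hs hs, sub_self, sub_self, abs_zero,
      Real.zero_rpow (by linarith), ← Real.rpow_natCast (|t - s| ^ H) 2,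
      ← Real.rpow_mul (abs_nonneg _)]
    push_cast
    rw [mul_comm H 2]
    ring

theorem IsFractionalBrownianMotion.ae_zero [IsProbabilityMeasure P]
    (hB : IsFractionalBrownianMotion H B P)
    (hH : 0 < H) : ∀ᵐ ω ∂P, B 0 ω = 0 := by
  have hsq : Integrable (fun ω => B 0 ω * B 0 ω) P :=
    (hB.hasGaussianLaw le_rfl).memLp_two.integrable_mul (hB.hasGaussianLaw le_rfl).memLp_two
  have h := hB.covariance 0 0 le_rfl le_rfl
  rw [sub_self, abs_zero, Real.zero_rpow (by linarith)] at h
  have h0 : ∫ ω, B 0 ω * B 0 ω ∂P = 0 := by rw [h]; ring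
  rw [integral_eq_zero_iff_of_nonneg (fun ω => mul_self_nonneg _) hsq] at h0
  filter_upwards [h0] with ω hω
  exact mul_self_eq_zero.1 hω

/-- Kolmogorov's criterion. A dyadic increment divided by δ^κ has p-th moment proportional to
δ^((H-κ)p), by Gaussian scaling. Level n has 2^n of them, so a large p makes the sum over all levels
finite. -/
theorem IsFractionalBrownianMotion.ae_holder [IsProbabilityMeasure P]
    (hB : IsFractionalBrownianMotion H B P) (hT : 0 < T) {κ : ℝ} (hκ : 0 < κ) (hκH : κ < H) :
    ∀ᵐ ω ∂P, ∃ C, ∀ r ∈ Icc 0 T, ∀ s ∈ Icc 0 T, |B r ω - B s ω| ≤ C * |r - s| ^ κ := by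
  have hH : 0 < H := hκ.trans hκH
  set d := H - κ with hd
  have hd0 : 0 < d := sub_pos.2 hκH
  have hx1 : ((1 / 2 : ℝ) ^ d) < 1 := Real.rpow_lt_one (by norm_num) (by norm_num) hd0
  have hx0 : 0 < ((1 / 2 : ℝ) ^ d) := by positivity
  -- Chosen so that the ratio q = 2 · 2^(-(H-κ)p) is less than 1.
  obtain ⟨p, hp⟩ := exists_pow_lt_of_lt_one (show (0 : ℝ) < 1 / 2 by norm_num) hx1
  have hp0 : p ≠ 0 := by rintro rfl; norm_num at hp
  set m := ∫⁻ x, ENNReal.ofReal (|x| ^ p) ∂(gaussianReal 0 1) with hm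
  have hmtop : m ≠ ∞ := (lintegral_abs_pow_gaussianReal_lt_top p).ne
  set D : ℕ → ℕ → Ω → ℝ := fun n k ω => B (grid T n (k + 1)) ω - B (grid T n k) ω with hD
  have hlaw : ∀ n k, HasGaussianLaw (D n k) P := fun n k =>
    hB.hasGaussianLaw_sub (grid_nonneg hT _ _) (grid_nonneg hT _ _)
  set q : ℝ := 2 * ((1 / 2 : ℝ) ^ d) ^ p with hq
  have hmom : ∀ n k, ∫⁻ ω, ENNReal.ofReal ((|D n k ω| / (T / 2 ^ n) ^ κ) ^ p) ∂P =
      ENNReal.ofReal ((((T / 2 ^ n) ^ d)) ^ p) * m := by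
    intro n k
    have hδ : 0 < T / 2 ^ n := by positivity
    obtain ⟨h1, h2⟩ := hB.integral_sub_sq hH (grid_nonneg hT n k) (grid_nonneg hT n (k + 1))
    rw [grid_succ_sub, abs_of_pos hδ] at h2
    have hms : ∀ ω, ENNReal.ofReal ((|D n k ω| / (T / 2 ^ n) ^ κ) ^ p) =
        ENNReal.ofReal (|D n k ω| ^ p) * ENNReal.ofReal ((((T / 2 ^ n) ^ κ) ^ p)⁻¹) := fun ω => by
      rw [← ENNReal.ofReal_mul (by positivity), div_pow, div_eq_mul_inv]
    simp only [hms]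
    rw [lintegral_mul_const'' _ (by have := (hlaw n k).aemeasurable; fun_prop),
      lintegral_abs_pow_of_hasGaussianLaw (hlaw n k) h1 (by positivity) h2 p, mul_right_comm,
      ← ENNReal.ofReal_mul (by positivity), ← inv_pow, ← mul_pow, ← div_eq_mul_inv,
      ← Real.rpow_sub hδ]
  have hsum := ae_tsum_lt_top (P := P)
    (a := fun n k ω => ENNReal.ofReal ((|D n k ω| / (T / 2 ^ n) ^ κ) ^ p))
    (fun n k => by have := (hlaw n k).aemeasurable; fun_prop)
    (C := (T ^ d) ^ p * m.toReal) (q := q) (by positivity) (by positivity) (by linarith)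
    (fun n => by
      simp only [hmom]
      rw [Finset.sum_const, Finset.card_range, nsmul_eq_mul]
      conv_lhs => rw [← ENNReal.ofReal_toReal hmtop]
      rw [← ENNReal.ofReal_mul (by positivity), ← ENNReal.ofReal_natCast,
        ← ENNReal.ofReal_mul (by positivity)]
      refine le_of_eq (congrArg _ ?_)
      have : (T / 2 ^ n) ^ d = T ^ d * ((1 / 2 : ℝ) ^ d) ^ n := by
        rw [div_eq_mul_one_div, ← one_div_pow, Real.mul_rpow hT.le (by positivity),
          ← Real.rpow_natCast, ← Real.rpow_natCast, ← Real.rpow_mul (by norm_num),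
          ← Real.rpow_mul (by norm_num), mul_comm d]
      rw [this, hq, mul_pow, mul_pow 2]
      push_cast
      ring)
  filter_upwards [hsum, hB.continuous_paths] with ω hω hcont
  set S := ∑' n, ∑ k ∈ Finset.range (2 ^ n),
    ENNReal.ofReal ((|D n k ω| / (T / 2 ^ n) ^ κ) ^ p) with hS
  -- The sum controls p-th powers, and y ≤ 1 + y^p for y ≥ 0.
  refine holder_of_grid (A := 1 + S.toReal) hT hκ (hcont.mono Icc_subset_Ici_self) ?_
  intro n k hk
  have hδ : 0 < (T / 2 ^ n) ^ κ := by positivity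
  have hle : ENNReal.ofReal ((|D n k ω| / (T / 2 ^ n) ^ κ) ^ p) ≤ S :=
    (Finset.single_le_sum (f := fun k => ENNReal.ofReal ((|D n k ω| / (T / 2 ^ n) ^ κ) ^ p))
      (fun _ _ => bot_le) (Finset.mem_range.2 hk)).trans (ENNReal.le_tsum n)
  have hle' : (|D n k ω| / (T / 2 ^ n) ^ κ) ^ p ≤ S.toReal :=
    (ENNReal.ofReal_le_iff_le_toReal hω.ne).1 hle
  rw [← div_le_iff₀ hδ]
  change |D n k ω| / (T / 2 ^ n) ^ κ ≤ 1 + S.toReal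
  have hS0 : 0 ≤ S.toReal := ENNReal.toReal_nonneg
  rcases le_or_gt (|D n k ω| / (T / 2 ^ n) ^ κ) 1 with h | h
  · linarith
  · have := le_self_pow₀ h.le hp0
    linarith

end

/-! ### Counting the dyadic intervals that meet the zero set. -/

open Classical in
/-- The intervals of the dyadic partition of level `n` that contain a zero of `ξ`. -/
noncomputable def zeroIntervals (T : ℝ) (ξ : ℝ → ℝ) (n : ℕ) : Finset ℕ :=
  (Finset.range (2 ^ n)).filter fun k => ∃ z ∈ Icc (grid T n k) (grid T n (k + 1)), ξ z = 0

theorem mem_zeroIntervals {T : ℝ} {ξ : ℝ → ℝ} {n k : ℕ} : k ∈ zeroIntervals T ξ n ↔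
    k < 2 ^ n ∧ ∃ z ∈ Icc (grid T n k) (grid T n (k + 1)), ξ z = 0 := by
  simp [zeroIntervals]

theorem sum_setLIntegral_grid {T : ℝ} (hT : 0 < T) (n : ℕ) (h : ℝ → ℝ≥0∞) (m : ℕ) :
    ∑ k ∈ Finset.range m, ∫⁻ s in Ioc (grid T n k) (grid T n (k + 1)), h s =
      ∫⁻ s in Ioc 0 (grid T n m), h s := by
  induction m with
  | zero => simp [grid_zero]
  | succ m ih =>
    rw [Finset.sum_range_succ, ih, ← lintegral_union measurableSet_Ioc
      (Ioc_disjoint_Ioc_of_le le_rfl),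
      Ioc_union_Ioc_eq_Ioc (grid_nonneg hT n m) (grid_mono hT n (Nat.le_succ m))]

section
variable {Ω : Type*} [MeasurableSpace Ω] {P : Measure Ω} {T γ ρ : ℝ} {x : ℝ → Ω → ℝ} {G : Ω → ℝ}

/-- Markov's inequality: on E the integrand of the negative moment is at least δ^(-ρ). Positivity of
G matters, since for G = 0 the integrand is 0 even where X = 0, by the convention 0 · ∞ = 0. -/
theorem measure_mul_le_negMoment (hγ : 0 < γ) (hρ : 0 < ρ) (hGm : AEMeasurable G P)
    {δ s : ℝ} (hδ : 0 < δ) (hx : AEMeasurable (x s) P) {E : Set Ω}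
    (hE : ∀ ω ∈ E, 0 < G ω ∧ |x s ω| ≤ G ω * δ ^ γ) :
    ENNReal.ofReal (δ ^ (-ρ)) * P E ≤ negMoment P G (x s) (ρ / γ) := by
  have hr : 0 < ρ / γ := div_pos hρ hγ
  set F : Ω → ℝ≥0∞ := fun ω =>
    ENNReal.ofReal (G ω) ^ (ρ / γ) * ENNReal.ofReal |x s ω| ^ (-(ρ / γ)) with hF
  have hFm : AEMeasurable F P := by
    have : AEMeasurable (fun ω => |x s ω|) P := measurable_abs.comp_aemeasurable hx
    exact (hGm.ennreal_ofReal.pow_const _).mul (this.ennreal_ofReal.pow_const _)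
  have hsub : E ⊆ {ω | ENNReal.ofReal (δ ^ (-ρ)) ≤ F ω} := by
    intro ω hω
    obtain ⟨hG, hxle⟩ := hE ω hω
    have hpos : 0 < G ω * δ ^ γ := by positivity
    have h1 : ENNReal.ofReal (δ ^ (-ρ)) =
        ENNReal.ofReal (G ω) ^ (ρ / γ) * ENNReal.ofReal (G ω * δ ^ γ) ^ (-(ρ / γ)) := by
      rw [ENNReal.ofReal_rpow_of_pos hG, ENNReal.ofReal_rpow_of_pos hpos,
        ← ENNReal.ofReal_mul (by positivity), Real.mul_rpow hG.le (by positivity),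
        ← Real.rpow_mul hδ.le, ← mul_assoc, ← Real.rpow_add hG, add_neg_cancel, Real.rpow_zero,
        one_mul]
      congr 2
      field_simp
    change ENNReal.ofReal (δ ^ (-ρ)) ≤ F ω
    rw [h1]
    simp only [hF]
    refine mul_le_mul' le_rfl ?_
    rw [ENNReal.rpow_neg, ENNReal.rpow_neg, ENNReal.inv_le_inv]
    gcongr
  calc _ ≤ ENNReal.ofReal (δ ^ (-ρ)) * P {ω | ENNReal.ofReal (δ ^ (-ρ)) ≤ F ω} := by gcongr
    _ ≤ ∫⁻ ω, F ω ∂P := mul_meas_ge_le_lintegral₀ hFm _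

/-- Almost surely, few dyadic intervals contain a zero of the process. -/
theorem ae_summable_card_zeroIntervals (hT : 0 < T) (hγ : 0 < γ) (hρ : 0 < ρ) (hργ : 1 < ρ + γ)
    (hx : ∀ s ∈ Icc 0 T, AEMeasurable (x s) P) (hGm : AEMeasurable G P)
    (hHolder : ∀ᵐ ω ∂P, ∀ s ∈ Icc 0 T, ∀ t ∈ Icc 0 T, |x s ω - x t ω| ≤ G ω * |s - t| ^ γ)
    (hzero : ∀ᵐ ω ∂P, volume {s : ℝ | s ∈ Icc 0 T ∧ x s ω = 0} = 0)
    (hf : ∫⁻ s in Icc 0 T, negMoment P G (x s) (ρ / γ) < ∞) :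
    ∀ᵐ ω ∂P, Summable fun n =>
      ((zeroIntervals T (fun s => x s ω) n).card : ℝ) * (T / 2 ^ n) ^ γ := by
  -- These events involve uncountably many times and are not known to be measurable; measurable
  -- hulls replace them below.
  set E : ℕ → ℕ → Set Ω := fun n k => {ω | (∀ s ∈ Icc 0 T, ∀ t ∈ Icc 0 T,
    |x s ω - x t ω| ≤ G ω * |s - t| ^ γ) ∧ 0 < G ω ∧
    k ∈ zeroIntervals T (fun s => x s ω) n} with hE
  set M := ∫⁻ s in Icc 0 T, negMoment P G (x s) (ρ / γ) with hM
  -- Every s in an interval with a zero lies within δ of that zero, so the pointwise Markov bound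
  -- holds for all these s. Integration over the interval supplies one more factor δ.
  have hbound : ∀ n, ∀ k < 2 ^ n, ENNReal.ofReal ((T / 2 ^ n) ^ (1 - ρ)) * P (E n k) ≤
      ∫⁻ s in Ioc (grid T n k) (grid T n (k + 1)), negMoment P G (x s) (ρ / γ) := by
    intro n k hk
    have hδ : 0 < T / 2 ^ n := by positivity
    have hk0 : grid T n k ∈ Icc 0 T := grid_mem hT hk.le
    have hk1 : grid T n (k + 1) ∈ Icc 0 T := grid_mem hT hk
    have hs : ∀ s ∈ Ioc (grid T n k) (grid T n (k + 1)),
        ENNReal.ofReal ((T / 2 ^ n) ^ (-ρ)) * P (E n k) ≤ negMoment P G (x s) (ρ / γ) := by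
      intro s hs
      have hsT : s ∈ Icc 0 T := ⟨hk0.1.trans hs.1.le, hs.2.trans hk1.2⟩
      refine measure_mul_le_negMoment hγ hρ hGm hδ (hx s hsT) ?_
      rintro ω ⟨hH, hG, hz⟩
      obtain ⟨-, z, hz, hxz⟩ := mem_zeroIntervals.1 hz
      have hzT : z ∈ Icc 0 T := ⟨hk0.1.trans hz.1, hz.2.trans hk1.2⟩
      refine ⟨hG, ?_⟩
      have := hH s hsT z hzT
      rw [hxz, sub_zero] at this
      refine this.trans ?_
      have hle : |s - z| ≤ T / 2 ^ n := by
        rw [← grid_succ_sub T n k, abs_le]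
        constructor <;> linarith [hs.1, hs.2, hz.1, hz.2]
      gcongr
    calc _ = ∫⁻ s in Ioc (grid T n k) (grid T n (k + 1)),
          ENNReal.ofReal ((T / 2 ^ n) ^ (-ρ)) * P (E n k) := by
          rw [setLIntegral_const, Real.volume_Ioc, grid_succ_sub, mul_right_comm,
            ← ENNReal.ofReal_mul (by positivity), ← Real.rpow_add_one hδ.ne', add_comm (-ρ),
            ← sub_eq_add_neg]
      _ ≤ _ := setLIntegral_mono' measurableSet_Ioc hs
  have hsum : ∀ n, ∑ k ∈ Finset.range (2 ^ n), ENNReal.ofReal ((T / 2 ^ n) ^ (1 - ρ)) * P (E n k) ≤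
      M := by
    intro n
    refine (Finset.sum_le_sum fun k hk => hbound n k (Finset.mem_range.1 hk)).trans ?_
    rw [sum_setLIntegral_grid hT, grid_pow]
    exact lintegral_mono_set Ioc_subset_Icc_self
  -- Each interval is weighted by δ^γ = δ^(ρ+γ-1) δ^(1-ρ). The second factor is absorbed by the
  -- bound above, and the first is geometric in n because ρ + γ > 1.
  have hae := ae_tsum_lt_top (P := P)
    (a := fun n k => (toMeasurable P (E n k)).indicator
      fun _ => ENNReal.ofReal ((T / 2 ^ n) ^ γ))
    (fun n k => (measurable_const.indicator (measurableSet_toMeasurable _ _)).aemeasurable)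
    (C := T ^ (ρ + γ - 1) * M.toReal) (q := (1 / 2) ^ (ρ + γ - 1)) (by positivity) (by positivity)
    (Real.rpow_lt_one (by norm_num) (by norm_num) (by linarith))
    (fun n => by
      have hδ : 0 < T / 2 ^ n := by positivity
      have hterm : ∀ k, ∫⁻ ω, (toMeasurable P (E n k)).indicator
          (fun _ => ENNReal.ofReal ((T / 2 ^ n) ^ γ)) ω ∂P =
          ENNReal.ofReal ((T / 2 ^ n) ^ (ρ + γ - 1)) *
            (ENNReal.ofReal ((T / 2 ^ n) ^ (1 - ρ)) * P (E n k)) := by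
        intro k
        rw [lintegral_indicator_const (measurableSet_toMeasurable _ _), measure_toMeasurable,
          ← mul_assoc, ← ENNReal.ofReal_mul (by positivity), ← Real.rpow_add hδ]
        congr 3; ring
      simp only [hterm]
      rw [← Finset.mul_sum]
      calc _ ≤ ENNReal.ofReal ((T / 2 ^ n) ^ (ρ + γ - 1)) * M := by gcongr; exact hsum n
        _ = _ := by
          conv_lhs => rw [← ENNReal.ofReal_toReal hf.ne]
          rw [← ENNReal.ofReal_mul (by positivity)]
          congr 1
          rw [div_eq_mul_one_div, ← one_div_pow, Real.mul_rpow hT.le (by positivity),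
            ← Real.rpow_natCast, ← Real.rpow_natCast, ← Real.rpow_mul (by norm_num),
            ← Real.rpow_mul (by norm_num), mul_comm (n : ℝ)]
          ring)
  filter_upwards [hae, hHolder, hzero] with ω hω hH hz
  have hcard : ∀ n, ((zeroIntervals T (fun s => x s ω) n).card : ℝ≥0∞) *
      ENNReal.ofReal ((T / 2 ^ n) ^ γ) ≤ ∑ k ∈ Finset.range (2 ^ n),
        (toMeasurable P (E n k)).indicator (fun _ => ENNReal.ofReal ((T / 2 ^ n) ^ γ)) ω := by
    intro n
    have hsub : zeroIntervals T (fun s => x s ω) n ⊆ Finset.range (2 ^ n) := fun k hk =>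
      Finset.mem_range.2 (mem_zeroIntervals.1 hk).1
    refine le_trans ?_ (Finset.sum_le_sum_of_subset hsub)
    rw [← nsmul_eq_mul, ← Finset.sum_const]
    refine Finset.sum_le_sum fun k hk => ?_
    -- If G ≤ 0, a path with one zero would vanish on all of [0, T], contrary to the zero set being
    -- null.
    have hG : 0 < G ω := by
      by_contra hG
      obtain ⟨hk', z, hzk, hxz⟩ := mem_zeroIntervals.1 hk
      have hzT : z ∈ Icc 0 T := ⟨(grid_nonneg hT n k).trans hzk.1, hzk.2.trans (grid_mem hT hk').2⟩
      have : {s : ℝ | s ∈ Icc 0 T ∧ x s ω = 0} = Icc 0 T := by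
        ext s
        refine ⟨fun h => h.1, fun hs => ⟨hs, ?_⟩⟩
        have h1 := hH s hs z hzT
        rw [hxz, sub_zero] at h1
        have h2 : G ω * |s - z| ^ γ ≤ 0 :=
          mul_nonpos_of_nonpos_of_nonneg (not_lt.1 hG) (by positivity)
        exact abs_nonpos_iff.1 (h1.trans h2)
      rw [this, Real.volume_Icc, sub_zero, ENNReal.ofReal_eq_zero] at hz
      linarith
    rw [indicator_of_mem (subset_toMeasurable P (E n k) ⟨hH, hG, hk⟩)]
  refine Summable.of_nonneg_of_le (fun n => by positivity) (fun n => ?_)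
    (ENNReal.summable_toReal hω.ne)
  have htop := ENNReal.ne_top_of_tsum_ne_top hω.ne n
  have := ENNReal.toReal_mono htop (hcard n)
  rwa [ENNReal.toReal_mul, ENNReal.toReal_natCast, ENNReal.toReal_ofReal (by positivity)] at this

end

/-! ### The coefficient σ and the transform Λ. -/

section
variable {α a : ℝ}

theorem one_div_sigma (α s : ℝ) : 1 / sigma α s = if 0 ≤ s then α else 1 - α := by
  unfold sigma
  split_ifs <;> rw [one_div_one_div]

theorem measurable_sigma (α : ℝ) : Measurable (sigma α) :=
  Measurable.ite measurableSet_Ici measurable_const measurable_const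

theorem sigma_pos (hα0 : 0 < α) (hα1 : α < 1) (s : ℝ) : 0 < sigma α s := by
  have : 0 < 1 - α := by linarith
  unfold sigma
  split_ifs <;> positivity

theorem abs_sigma_le (hα0 : 0 < α) (hα1 : α < 1) (s : ℝ) :
    |sigma α s| ≤ 1 / α + 1 / (1 - α) := by
  have h1 : 0 < 1 / α := by positivity
  have h2 : 0 < 1 / (1 - α) := one_div_pos.2 (by linarith)
  rw [abs_of_pos (sigma_pos hα0 hα1 s), sigma]
  split_ifs <;> linarith

theorem sigma_congr {y z : ℝ} (h : 0 ≤ y ↔ 0 ≤ z) : sigma α y = sigma α z := by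
  simp only [sigma, h]

theorem one_div_sigma_mem (hα0 : 0 < α) (hα1 : α < 1) (s : ℝ) :
    0 < 1 / sigma α s ∧ 1 / sigma α s ≤ 1 := by
  rw [one_div_sigma]
  split_ifs <;> constructor <;> linarith

theorem intervalIntegrable_one_div_sigma (hα0 : 0 < α) (hα1 : α < 1) (y z : ℝ) :
    IntervalIntegrable (fun s => 1 / sigma α s) volume y z := by
  refine (intervalIntegrable_const (c := (1 : ℝ))).mono_fun'
    ((measurable_const.div (measurable_sigma α)).aestronglyMeasurable) (ae_of_all _ fun s => ?_)
  have := one_div_sigma_mem hα0 hα1 s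
  simp only [Real.norm_eq_abs]
  rw [abs_of_pos this.1]
  exact this.2

theorem Lambda_sub (hα0 : 0 < α) (hα1 : α < 1) (a y z : ℝ) :
    Lambda α a y - Lambda α a z = ∫ s in z..y, 1 / sigma α s := by
  have hi := intervalIntegrable_one_div_sigma hα0 hα1
  exact intervalIntegral.integral_interval_sub_left (hi _ _) (hi _ _)

theorem abs_Lambda_sub_le (hα0 : 0 < α) (hα1 : α < 1) (a y z : ℝ) :
    |Lambda α a y - Lambda α a z| ≤ |y - z| := by
  rw [Lambda_sub hα0 hα1, ← Real.norm_eq_abs, ← one_mul |y - z|]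
  refine intervalIntegral.norm_integral_le_of_norm_le_const fun s _ => ?_
  have := one_div_sigma_mem hα0 hα1 s
  rw [Real.norm_eq_abs, abs_of_pos this.1]
  exact this.2

theorem Lambda_sub_of_same_sign (hα0 : 0 < α) (hα1 : α < 1) (a : ℝ) {y z : ℝ}
    (h : 0 ≤ y ↔ 0 ≤ z) : Lambda α a y - Lambda α a z = (y - z) / sigma α z := by
  rw [Lambda_sub hα0 hα1, intervalIntegral.integral_congr (g := fun _ => 1 / sigma α z)]
  · rw [intervalIntegral.integral_const, smul_eq_mul]; ring
  · intro s hs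
    have : sigma α s = sigma α z := by
      refine sigma_congr ?_
      rw [mem_uIcc] at hs
      constructor
      · intro hs0
        by_contra hz
        rcases hs with hs | hs
        · exact hz (h.1 (hs0.trans hs.2))
        · exact hz (hs0.trans hs.2)
      · intro hz0
        rcases hs with hs | hs
        · exact hz0.trans hs.1
        · exact (h.2 hz0).trans hs.1
    simp only [this]

theorem Lambda_strictMono (hα0 : 0 < α) (hα1 : α < 1) (a : ℝ) : StrictMono (Lambda α a) := by
  intro y z hyz
  rw [← sub_pos, Lambda_sub hα0 hα1]
  exact intervalIntegral.intervalIntegral_pos_of_pos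
    (intervalIntegrable_one_div_sigma hα0 hα1 _ _) (fun s => (one_div_sigma_mem hα0 hα1 s).1) hyz

end

/-! ### The pathwise argument. -/

section
variable {α a H T γ A : ℝ} {β ξ : ℝ → ℝ}

theorem continuousOn_of_holderOn {C κ : ℝ} {g : ℝ → ℝ} (hT : 0 < T) (hκ : 0 < κ)
    (hg : ∀ r ∈ Icc 0 T, ∀ s ∈ Icc 0 T, |g r - g s| ≤ C * |r - s| ^ κ) :
    ContinuousOn g (Icc 0 T) := by
  obtain ⟨-, hH, -, -, heq⟩ := clipSub_holder hT hκ hg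
  refine (((continuous_of_holder hκ hH).add_const (g T)).continuousOn).congr fun r hr => ?_
  simp only
  rw [heq hr, sub_add_cancel]

theorem nonneg_iff_of_no_zero {u v : ℝ} (hξ : ContinuousOn ξ (Icc u v))
    (h0 : ∀ z ∈ Icc u v, ξ z ≠ 0) {s : ℝ} (hs : s ∈ Icc u v) : 0 ≤ ξ s ↔ 0 ≤ ξ u := by
  have hu : u ∈ Icc u v := ⟨le_rfl, hs.1.trans hs.2⟩
  have hsub : uIcc u s ⊆ Icc u v := ordConnected_Icc.uIcc_subset hu hs
  have hiv := intermediate_value_uIcc (hξ.mono hsub)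
  have hno : (0 : ℝ) ∉ uIcc (ξ u) (ξ s) := by
    intro h
    obtain ⟨z, hz, hz0⟩ := hiv h
    exact h0 z (hsub hz) hz0
  rw [mem_uIcc] at hno
  constructor <;> intro h <;> by_contra hneg
  · exact hno (Or.inl ⟨(not_le.1 hneg).le, h⟩)
  · exact hno (Or.inr ⟨(not_le.1 hneg).le, h⟩)

/-- The increments of a solution over dyadic intervals without zeros. -/
theorem IsPathwiseSolution.sub_eq (hα0 : 0 < α) (hα1 : α < 1) (hT : 0 < T) (hH1 : H < 1)
    (hγ : 0 < γ) (hγH : γ < H)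
    (hξ : ∀ s ∈ Icc 0 T, ∀ t ∈ Icc 0 T, |ξ s - ξ t| ≤ A * |s - t| ^ γ)
    (hβ : ∀ κ : ℚ, 0 < (κ : ℝ) → (κ : ℝ) < H →
      ∃ C, ∀ r ∈ Icc 0 T, ∀ s ∈ Icc 0 T, |β r - β s| ≤ C * |r - s| ^ (κ : ℝ))
    (hN : Summable fun n => ((zeroIntervals T ξ n).card : ℝ) * (T / 2 ^ n) ^ γ)
    (hsol : IsPathwiseSolution α H T β ξ) {n k : ℕ} (hk : k < 2 ^ n)
    (hkz : k ∉ zeroIntervals T ξ n) :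
    ξ (grid T n (k + 1)) - ξ (grid T n k) =
      sigma α (ξ (grid T n k)) * (β (grid T n (k + 1)) - β (grid T n k)) := by
  set f : ℝ → ℝ := fun s => sigma α (ξ s) with hf
  have hξc := continuousOn_of_holderOn hT hγ hξ
  have hconst : ∀ n k, k < 2 ^ n → k ∉ zeroIntervals T ξ n →
      ∀ s ∈ Icc (grid T n k) (grid T n (k + 1)), f s = f (grid T n k) := by
    intro n k hk hkz s hs
    refine sigma_congr (nonneg_iff_of_no_zero (v := grid T n (k + 1)) (hξc.mono ?_) ?_ hs)
    · exact Icc_subset_Icc (grid_nonneg hT n k) (grid_mem hT hk).2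
    · exact fun z hz hz0 => hkz (mem_zeroIntervals.2 ⟨hk, z, hz, hz0⟩)
  have hcard : ∀ n, (nonflat T f n).card ≤ (zeroIntervals T ξ n).card := by
    intro n
    refine Finset.card_le_card fun k hk => ?_
    simp only [nonflat, Finset.mem_filter, Finset.mem_range] at hk
    by_contra hkz
    exact hk.2 (hconst n k hk.1 hkz)
  have hfm : Measurable ((Icc 0 T).indicator f) := by
    obtain ⟨-, hH, -, -, heq⟩ := clipSub_holder hT hγ hξ
    have hc : Continuous fun r => clipSub T ξ r + ξ T :=
      (continuous_of_holder hγ hH).add_const _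
    have : (Icc 0 T).indicator f =
        (Icc 0 T).indicator fun r => sigma α (clipSub T ξ r + ξ T) := by
      refine indicator_congr fun r hr => ?_
      rw [heq hr, sub_add_cancel]
    rw [this]
    exact ((measurable_sigma α).comp hc.measurable).indicator measurableSet_Icc
  have hlim : ∀ m ≤ 2 ^ n, Tendsto (fun j => ∑ k ∈ Finset.range (m * 2 ^ j),
      f (grid T (n + j) k) * (β (grid T (n + j) (k + 1)) - β (grid T (n + j) k))) atTop
      (𝓝 (ξ (grid T n m) - ξ 0)) := by
    intro m hm
    rcases Nat.eq_zero_or_pos m with rfl | hm0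
    · simp [grid_zero]
    · have hpos : 0 < grid T n m := by simp only [grid]; positivity
      obtain ⟨θ, hθ, hI⟩ := hsol (grid T n m) ⟨hpos, (grid_mem hT hm).2⟩
      -- The order θ varies with the end point, and κ > 1 - θ is chosen accordingly; κ > γ keeps the
      -- zero count summable. The Riemann sums obtained involve neither θ nor κ.
      obtain ⟨κ, hκ1, hκ2⟩ := exists_rat_btwn
        (max_lt hγH (by linarith [hθ.1]) : max γ (1 - θ) < H)
      have hγκ : γ < κ := (le_max_left _ _).trans_lt hκ1
      obtain ⟨C, hC⟩ := hβ κ (hγ.trans hγκ) hκ2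
      refine hI.tendsto_riemannSum (by linarith [hθ.1]) hθ.2 hT ((le_max_right _ _).trans_lt hκ1)
        (hκ2.trans hH1) hfm (fun s _ => abs_sigma_le hα0 hα1 _) hC ?_ hm0 hm
      refine Summable.of_nonneg_of_le (fun n => by positivity) (fun n => ?_)
        (hN.mul_left (T ^ ((κ : ℝ) - γ)))
      have hδ : 0 < T / 2 ^ n := by positivity
      have hδT : T / 2 ^ n ≤ T := div_le_self hT.le (one_le_pow₀ one_le_two)
      have hcn : ((nonflat T f n).card : ℝ) ≤ (zeroIntervals T ξ n).card := by
        exact_mod_cast hcard n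
      calc ((nonflat T f n).card : ℝ) * (T / 2 ^ n) ^ (κ : ℝ)
          ≤ (zeroIntervals T ξ n).card * ((T / 2 ^ n) ^ ((κ : ℝ) - γ) * (T / 2 ^ n) ^ γ) := by
            rw [← Real.rpow_add hδ, sub_add_cancel]
            gcongr
        _ ≤ (zeroIntervals T ξ n).card * (T ^ ((κ : ℝ) - γ) * (T / 2 ^ n) ^ γ) := by
            have : 0 ≤ (κ : ℝ) - γ := by linarith
            gcongr
        _ = _ := by ring
  -- Subtracting the limits for the two end points restores additivity: what is left are the Riemann
  -- sums over one interval, where f is constant and the increments of β telescope.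
  have hdiff := (hlim (k + 1) hk).sub (hlim k hk.le)
  rw [sub_sub_sub_cancel_right] at hdiff
  refine tendsto_nhds_unique hdiff (tendsto_const_nhds.congr fun j => ?_)
  have hle : k * 2 ^ j ≤ (k + 1) * 2 ^ j := Nat.mul_le_mul_right _ (Nat.le_succ k)
  rw [← Finset.sum_Ico_eq_sub _ hle]
  have hterm : ∀ i ∈ Finset.Ico (k * 2 ^ j) ((k + 1) * 2 ^ j),
      f (grid T (n + j) i) * (β (grid T (n + j) (i + 1)) - β (grid T (n + j) i)) =
      f (grid T n k) * (β (grid T (n + j) (i + 1)) - β (grid T (n + j) i)) := by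
    intro i hi
    rw [Finset.mem_Ico] at hi
    rw [hconst n k hk hkz (grid T (n + j) i)]
    constructor
    · rw [← grid_add T n j]; exact grid_mono hT _ hi.1
    · rw [← grid_add T n j]; exact grid_mono hT _ hi.2.le
  rw [Finset.sum_congr rfl hterm, ← Finset.mul_sum,
    Finset.sum_Ico_sub (fun i => β (grid T (n + j) i)) hle, grid_add, grid_add]

/-- Along the grid Λ(ξ) - β changes only across intervals with zeros, by at most (A + C) δ^γ each.
The terms of the summable series tend to 0, so in the limit nothing is left; continuity passes from
grid points to t. -/
theorem IsPathwiseSolution.Lambda_sub_eq (hα0 : 0 < α) (hα1 : α < 1) (hT : 0 < T) (hH1 : H < 1)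
    (hγ : 0 < γ) (hγH : γ < H)
    (hξ : ∀ s ∈ Icc 0 T, ∀ t ∈ Icc 0 T, |ξ s - ξ t| ≤ A * |s - t| ^ γ)
    (hβ : ∀ κ : ℚ, 0 < (κ : ℝ) → (κ : ℝ) < H →
      ∃ C, ∀ r ∈ Icc 0 T, ∀ s ∈ Icc 0 T, |β r - β s| ≤ C * |r - s| ^ (κ : ℝ))
    (hβγ : ∃ C, ∀ r ∈ Icc 0 T, ∀ s ∈ Icc 0 T, |β r - β s| ≤ C * |r - s| ^ γ)
    (hN : Summable fun n => ((zeroIntervals T ξ n).card : ℝ) * (T / 2 ^ n) ^ γ)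
    (hsol : IsPathwiseSolution α H T β ξ) (hβ0 : β 0 = 0) {t : ℝ} (ht : t ∈ Icc 0 T) :
    Lambda α a (ξ t) - Lambda α a (ξ 0) = β t := by
  obtain ⟨C, hC⟩ := hβγ
  have hA0 := (clipSub_holder hT hγ hξ).1
  have hC0 := (clipSub_holder hT hγ hC).1
  have hξc := continuousOn_of_holderOn hT hγ hξ
  have hβc := continuousOn_of_holderOn hT hγ hC
  set Φ : ℝ → ℝ := fun t => Lambda α a (ξ t) - β t with hΦ
  have hbound : ∀ n, ∀ m ≤ 2 ^ n, |Φ (grid T n m) - Φ 0| ≤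
      (zeroIntervals T ξ n).card * ((A + C) * (T / 2 ^ n) ^ γ) := by
    intro n m hm
    rw [← grid_zero T n, ← Finset.sum_range_sub (fun k => Φ (grid T n k))]
    refine abs_sum_range_le_card_mul (fun k hk _ => ?_) (fun k hk hkz => ?_) (by positivity)
    · have hk0 : grid T n k ∈ Icc 0 T := grid_mem hT (by omega)
      have hk1 : grid T n (k + 1) ∈ Icc 0 T := grid_mem hT (by omega)
      have h1 := (abs_Lambda_sub_le hα0 hα1 a (ξ (grid T n (k + 1))) (ξ (grid T n k))).trans
        (hξ _ hk1 _ hk0)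
      have h2 := hC _ hk1 _ hk0
      rw [grid_succ_sub, abs_of_pos (by positivity : 0 < T / 2 ^ n)] at h1 h2
      simp only [hΦ]
      rw [sub_sub_sub_comm, add_mul]
      exact (abs_sub _ _).trans (add_le_add h1 h2)
    · have hk2 : k < 2 ^ n := by omega
      have hinc := hsol.sub_eq hα0 hα1 hT hH1 hγ hγH hξ hβ hN hk2 hkz
      have hsign : 0 ≤ ξ (grid T n (k + 1)) ↔ 0 ≤ ξ (grid T n k) := by
        refine nonneg_iff_of_no_zero (v := grid T n (k + 1)) (hξc.mono ?_) ?_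
          ⟨grid_mono hT n (Nat.le_succ k), le_rfl⟩
        · exact Icc_subset_Icc (grid_nonneg hT n k) (grid_mem hT hk2).2
        · exact fun z hz hz0 => hkz (mem_zeroIntervals.2 ⟨hk2, z, hz, hz0⟩)
      simp only [hΦ]
      rw [sub_sub_sub_comm, Lambda_sub_of_same_sign hα0 hα1 a hsign, hinc,
        mul_div_cancel_left₀ _ (sigma_pos hα0 hα1 _).ne', sub_self]
  have hzero : Tendsto (fun n => ((zeroIntervals T ξ n).card : ℝ) *
      ((A + C) * (T / 2 ^ n) ^ γ)) atTop (𝓝 0) := by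
    have := hN.tendsto_atTop_zero.const_mul (A + C)
    rw [mul_zero] at this
    exact this.congr fun n => by ring
  have hΛ : Continuous (Lambda α a) := by
    refine continuous_of_holder (C := 1) (κ := 1) one_pos fun r s => ?_
    rw [one_mul, Real.rpow_one]
    exact abs_Lambda_sub_le hα0 hα1 a r s
  have hΦc : ContinuousOn Φ (Icc 0 T) := (hΛ.comp_continuousOn hξc).sub hβc
  have hlim : Tendsto (fun n => |Φ (grid T n ⌊t * 2 ^ n / T⌋₊) - Φ 0|) atTop (𝓝 |Φ t - Φ 0|) :=
    (((hΦc t ht).tendsto.comp (tendsto_grid_floor hT ht)).sub_const _).abs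
  have hle := le_of_tendsto_of_tendsto' hlim hzero fun n =>
    hbound n _ (floor_le_two_pow hT n ht)
  have heq : Φ t - Φ 0 = 0 := abs_nonpos_iff.1 hle
  simp only [hΦ, hβ0] at heq
  linarith

end

/-! ### Conclusion. -/

theorem mainTheorem2 {Ω : Type*} [MeasurableSpace Ω] (P : Measure Ω) [IsProbabilityMeasure P]
    (α H T γ α' ε η p q a : ℝ) (B x : ℝ → Ω → ℝ) (G : Ω → ℝ) (g : ℝ → ℝ)
    (hα0 : 0 < α) (hα1 : α < 1) (hH1 : H < 1) (hT : 0 < T)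
    (hγ : 1 / 2 < γ) (hγH : γ < H) (hα'1 : 1 - γ < α') (hα'2 : α' < γ)
    (hB : IsFractionalBrownianMotion H B P)
    (hx_meas : ∀ s ∈ Icc 0 T, AEMeasurable (x s) P)
    (hG_meas : AEMeasurable G P)
    -- `x` is `γ`-Hölder continuous with random Hölder constant `G`
    (hHolder : ∀ᵐ ω ∂P, ∀ s ∈ Icc 0 T, ∀ t ∈ Icc 0 T, |x s ω - x t ω| ≤ G ω * |s - t| ^ γ)
    (hsol : ∀ᵐ ω ∂P, IsPathwiseSolution α H T (fun t => B t ω) (fun t => x t ω))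
    (hint : ∀ᵐ ω ∂P, IntegrableOn
      (fun z : ℝ × ℝ => (sigma α (x z.2 ω) - sigma α (x z.1 ω)) / (z.2 - z.1) ^ (1 + α'))
      {z : ℝ × ℝ | 0 ≤ z.1 ∧ z.1 < z.2 ∧ z.2 < T})
    (hzero : ∀ᵐ ω ∂P, volume {s : ℝ | s ∈ Icc 0 T ∧ x s ω = 0} = 0)
    (hε : 0 < ε)
    (hf : ∫⁻ s in Icc 0 T, negMoment P G (x s) ((α' + ε) / γ) < ∞)
    (hη : η < 1 - α' / γ) (hp1 : 1 < p) (hp2 : p < 1 / (1 - η)) (hpq : 1 / p + 1 / q = 1)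
    (hG : MemLp (fun ω => G ω ^ (1 - η)) (ENNReal.ofReal q) P)
    (hg : MemLp g (ENNReal.ofReal (1 / p)) (volume.restrict (Icc 0 T)))
    (hdens : ∀ᵐ s ∂(volume.restrict (Icc 0 T)), ∀ u v : ℝ, u < v →
      P.real {ω | u < x s ω ∧ x s ω ≤ v} ≤ g s * (v - u)) :
    ∀ᵐ ω ∂P, ∀ t ∈ Icc 0 T,
      Lambda α a (x t ω) - Lambda α a (x 0 ω) = B t ω ∧
      -- `x_t = Λ⁻¹(Λ(x_0) + B_t)`, so that `x` is determined by `x_0` and `B`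
      ∀ y : ℝ, Lambda α a y = Lambda α a (x 0 ω) + B t ω ↔ y = x t ω := by

  have hγ0 : 0 < γ := by linarith
  have hα'0 : 0 < α' := by linarith
  -- Here ρ = α' + ε, and ρ + γ > 1 is where 1 - γ < α' enters.
  have hcount := ae_summable_card_zeroIntervals hT hγ0 (by linarith : 0 < α' + ε) (by linarith)
    hx_meas hG_meas hHolder hzero hf
  -- The order of the integral may depend on ω and t, so all exponents below H are needed on a
  -- single event of probability one; rational exponents suffice and are countably many.
  have hBκ : ∀ᵐ ω ∂P, ∀ κ : ℚ, 0 < (κ : ℝ) → (κ : ℝ) < H →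
      ∃ C, ∀ r ∈ Icc 0 T, ∀ s ∈ Icc 0 T, |B r ω - B s ω| ≤ C * |r - s| ^ (κ : ℝ) := by
    refine ae_all_iff.2 fun κ => ?_
    by_cases h : 0 < (κ : ℝ) ∧ (κ : ℝ) < H
    · filter_upwards [hB.ae_holder hT h.1 h.2] with ω hω _ _
      exact hω
    · exact ae_of_all _ fun ω h1 h2 => absurd ⟨h1, h2⟩ h
  filter_upwards [hcount, hBκ, hB.ae_holder hT hγ0 hγH, hB.ae_zero (hγ0.trans hγH), hHolder, hsol]
    with ω h1 h2 h3 h4 h5 h6 t ht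
  have key : Lambda α a (x t ω) - Lambda α a (x 0 ω) = B t ω :=
    h6.Lambda_sub_eq hα0 hα1 hT hH1 hγ0 hγH h5 h2 h3 h1 h4 ht
  refine ⟨key, fun y => ?_⟩
  rw [← key, add_sub_cancel, (Lambda_strictMono hα0 hα1 a).injective.eq_iff]
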